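/- Let $v_{4,0},v_{2,2},v_{0,4},v_{6,0},v_{4,2},v_{2,4},v_{0,6}$ be real numbers and put $$A=\tfrac38(v_{4,0}+v_{0,4}),\qquad B=\tfrac34(v_{4,0}-v_{0,4}),\qquad C=\tfrac18 v_{2,2}.$$ Consider the detuned normal form, with detuning $\delta$ and $c=\cos(2\phi_1-2\phi_2)$, $$\begin{aligned}K={}&J_1+J_2+\delta J_1+\tfrac32v_{4,0}J_1^2+\tfrac32v_{0,4}J_2^2+\tfrac12v_{2,2}J_1J_2(2+c)-\delta\left[3v_{4,0}J_1^2+\tfrac12v_{2,2}J_1J_2(2+c)\right]\\&+\tfrac14(10v_{6,0}-17v_{4,0}^2)J_1^3+\tfrac14(10v_{0,6}-17v_{0,4}^2)J_2^3\\&+\tfrac14J_1^2J_2\left[6v_{4,2}-\tfrac94v_{2,2}^2-12v_{2,2}v_{4,0}+(4v_{4,2}-2v_{2,2}^2-5v_{2,2}v_{4,0})c\right]\\&+\tfrac14J_1J_2^2\left[6v_{2,4}-\tfrac94v_{2,2}^2-12v_{2,2}v_{0,4}+(4v_{2,4}-2v_{2,2}^2-5v_{2,2}v_{0,4})c\right].\end{aligned}$$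 Let $\mathcal K(x,y;\mathcal E,\delta)$ be the planar Hamiltonian obtained from it by $J_1=J$, $J_2=\mathcal E-J$, $\psi=\phi_1-\phi_2$, $x=\sqrt{2J}\cos\psi$, $y=\sqrt{2J}\sin\psi$, plus an arbitrary polynomial in $x^2,y^2,\mathcal E,\delta$ all of whose terms have degree at least $4$ in these four quantities. Let $s_{i,j}$ be the coefficient of $x^iy^j$ in $\mathcal K(x,y;0,0)$; in particular $s_{4,0}=A-3C$, $s_{2,2}=2(A-2C)$, $s_{0,4}=A-C$. Assume $C\ne A$, $C\ne A/3$ and $C\neq0$. Put $P=|A-3C|$, $Q=|A-C|$, $$\epsilon_1=\frac{A-3C}{P},\quad \epsilon_2=\frac{A-C}{Q},\quad \mu=\frac{2(A-2C)}{\sqrt{PQ}},\quad f(x,y)=\epsilon_1x^4+\mu x^2y^2+\epsilon_2y^4,$$ $$t_{6,0}=\frac{s_{6,0}}{P^{3/2}},\quad t_{4,2}=\frac{s_{4,2}}{PQ^{1/2}},\quad t_{2,4}=\frac{s_{2,4}}{P^{1/2}Q},\quad t_{0,6}=\frac{s_{0,6}}{Q^{3/2}},$$ let $S(x,y)=(P^{-1/4}x,\,Q^{-1/4}y)$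 and let $\Phi_3$ be the map $$\begin{aligned}x&\mapsto x+\frac{\epsilon_1(2\epsilon_2t_{2,4}-\mu t_{0,6})\mu+2\mu t_{6,0}-4\epsilon_1t_{4,2}}{4\epsilon_1\epsilon_2(4\epsilon_1\epsilon_2-\mu^2)}\,xy^2-\frac{t_{6,0}\epsilon_1}{4}x^3,\\ y&\mapsto y+\frac{\epsilon_2(2\epsilon_1t_{4,2}-\mu t_{6,0})\mu+2\mu t_{0,6}-4\epsilon_2t_{2,4}}{4\epsilon_1\epsilon_2(4\epsilon_1\epsilon_2-\mu^2)}\,x^2y-\frac{t_{0,6}\epsilon_2}{4}y^3.\end{aligned}$$ Say that a map $\Phi$ of the plane with $\Phi(0)=0$ brings $\mathcal K$ to the form $\mathcal K_b$ if, as $(x,y,\mathcal E,\delta)\to0$, $$\begin{aligned}\mathcal K(\Phi(x,y);\mathcal E,\delta)-\mathcal K(0,0;\mathcal E,\delta)={}&(a_1\mathcal E+a_2\mathcal E^2+b_1\mathcal E+b_2)x^2+(a_3\mathcal E+a_4\mathcal E^2+b_3\mathcal E+b_4)y^2\\&+(\epsilon_1+a_5\mathcal E+b_5)x^4+(\mu+a_6\mathcal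 E+b_6)x^2y^2+(\epsilon_2+a_7\mathcal E+b_7)y^4\\&+O\big((x^2+y^2+|\mathcal E|+|\delta|)^4\big),\end{aligned}$$ with the coefficients $a_i$ (constants) and parameters $b_i$ (linear in $\delta$) listed below. Then there is a diffeomorphism $\varphi$ of class $C^\infty$ between two open neighbourhoods of the origin of $\mathbb R^2$, with $\varphi(0)=0$, independent of $\mathcal E$ and $\delta$, commuting with the reflections $(x,y)\mapsto(-x,y)$ and $(x,y)\mapsto(x,-y)$, such that (i) $\varphi(x,y)=\Phi_3(x,y)+O(|(x,y)|^5)$; (ii) $\mathcal K(S(\varphi(x,y));0,0)=f(x,y)$ for all $(x,y)$ near the origin; (iii) $\Phi=S\circ\varphi$ brings $\mathcal K$ to the form $\mathcal K_b$. Moreover, the explicit map $S\circ\Phi_3$ also brings $\mathcal K$ to the form $\mathcal K_b$. The coefficients are $$a_1=\frac{B-2A+6C}{\sqrt P},\qquad a_3=\frac{B-2A+2C}{\sqrt Q},$$ $$a_2=\frac{136A^2-136AB+34B^2-272AC+136BC-408C^2+15v_{2,4}-45v_{0,6}}{12\sqrt P},$$ $$a_4=\frac{136A^2-136AB+34B^2-112AC+56BC-24C^2+3v_{2,4}-45v_{0,6}}{12\sqrt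 Q},$$ $$\begin{aligned}a_5=\frac{-\epsilon_1}{288(A-3C)^2}\Big(&1632A^3-544A^2(2B+15C)\\&+2A\big(68B^2+3264BC+9(272C^2-5(v_{6,0}+v_{4,2}-3v_{2,4}+5v_{0,6}))\big)\\&+3\big(-136B^2C-3B(1088C^2-5(v_{6,0}-v_{4,2}+v_{2,4}-v_{0,6}))\\&\quad+18C(272C^2+5(v_{6,0}+v_{4,2}-3v_{2,4}+5v_{0,6}))\big)\Big),\end{aligned}$$ $$\begin{aligned}a_6=\frac{\epsilon_1\epsilon_2}{144\,Q^{3/2}P^{3/2}}\Big[&-1632A^4+64A^3(17B+138C)\\&-2A^2\big(68B^2+3328BC+9(640C^2-5v_{6,0}-3v_{4,2}+9v_{2,4}-25v_{0,6})\big)\\&+A\big(512B^2C-72C(48C^2+5v_{6,0}+2v_{4,2}-8v_{2,4}+25v_{0,6})\\&\quad+B(12608C^2-45v_{6,0}+27v_{4,2}-27v_{2,4}+45v_{0,6})\big)\\&-6C\big(52B^2C+B(1216C^2-15v_{6,0}+6v_{4,2}-6v_{2,4}+15v_{0,6})\\&\quad-3C(432C^2+5v_{6,0}+7v_{4,2}-25v_{2,4}+85v_{0,6})\big)\Big],\end{aligned}$$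 $$\begin{aligned}a_7=\frac{-\epsilon_2}{288(A-C)^2}\Big(&1632A^3-32A^2(34B+93C)\\&+2A\big(68B^2+1216BC+528C^2-225v_{0,6}+27v_{2,4}-9v_{4,2}-45v_{6,0}\big)\\&+3\big(-24B^2C-B(448C^2+3(5v_{0,6}-v_{2,4}+v_{4,2}-5v_{6,0}))\\&\quad+6C(16C^2+25v_{0,6}-3v_{2,4}+v_{4,2}+5v_{6,0})\big)\Big),\end{aligned}$$ $$b_1=-\frac{6C\delta}{\sqrt P},\quad b_2=\frac{\delta}{2\sqrt P},\quad b_3=-\frac{2C\delta}{\sqrt Q},\quad b_4=\frac{\delta}{2\sqrt Q},$$ $$b_5=-\epsilon_1\frac{576A^2+16AB-3456AC-48BC+5184C^2+45(v_{6,0}-v_{4,2}+v_{2,4}-v_{0,6})}{576(A-3C)^2}\,\delta,$$ $$\begin{aligned}b_6=\epsilon_1\epsilon_2\big(&-576A^3-16A^2B+3456A^2C+32ABC-6336AC^2+48BC^2+3456C^3\\&-45Av_{6,0}+90Cv_{6,0}+27Av_{4,2}-36Cv_{4,2}-27Av_{2,4}+36Cv_{2,4}+45Av_{0,6}-90Cv_{0,6}\big)\frac{\delta}{288\,Q^{3/2}P^{3/2}},\end{aligned}$$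 $$b_7=-\epsilon_2\frac{576A^2+16A(B-72C)+48BC+9(64C^2+5v_{6,0}-v_{4,2}+v_{2,4}-5v_{0,6})}{576(A-C)^2}\,\delta.$$ -/

import Mathlib

open Filter Topology Asymptotics
open scoped ContDiff

namespace Resonance22

/-- Coefficients `v_{i,j}` of the monomials `x₁ ^ i * x₂ ^ j` of the quartic and sextic parts of the
potential of a natural Hamiltonian with two degrees of freedom and two reflection symmetries. -/
structure Potential where
  (v40 v22 v04 v60 v42 v24 v06 : ℝ)

namespace Potential

variable (v : Potential)

/-! ### The detuned normal form and its reduction to the plane -/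

/-- The quadratic normal form term `K₀` in action variables. -/
noncomputable def K0 (J₁ J₂ : ℝ) : ℝ := J₁ + J₂

/-- The normal form term `K₂` in action-angle variables. -/
noncomputable def K2 (δ J₁ J₂ φ₁ φ₂ : ℝ) : ℝ :=
  δ * J₁ + 3 / 2 * v.v40 * J₁ ^ 2 + 3 / 2 * v.v04 * J₂ ^ 2
    + 1 / 2 * v.v22 * J₁ * J₂ * (2 + Real.cos (2 * φ₁ - 2 * φ₂))

/-- The normal form term `K₄` in action-angle variables. -/
noncomputable def K4 (δ J₁ J₂ φ₁ φ₂ : ℝ) : ℝ :=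
  -δ * (3 * v.v40 * J₁ ^ 2 + 1 / 2 * v.v22 * J₁ * J₂ * (2 + Real.cos (2 * φ₁ - 2 * φ₂)))
    + 1 / 4 * (10 * v.v60 - 17 * v.v40 ^ 2) * J₁ ^ 3
    + 1 / 4 * (10 * v.v06 - 17 * v.v04 ^ 2) * J₂ ^ 3
    + 1 / 4 * J₁ ^ 2 * J₂ *
      (6 * v.v42 - 9 / 4 * v.v22 ^ 2 - 12 * v.v22 * v.v40
        + (4 * v.v42 - 2 * v.v22 ^ 2 - 5 * v.v22 * v.v40) * Real.cos (2 * φ₁ - 2 * φ₂))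
    + 1 / 4 * J₁ * J₂ ^ 2 *
      (6 * v.v24 - 9 / 4 * v.v22 ^ 2 - 12 * v.v22 * v.v04
        + (4 * v.v24 - 2 * v.v22 ^ 2 - 5 * v.v22 * v.v04) * Real.cos (2 * φ₁ - 2 * φ₂))

/-- The normal form `K₀ + K₂ + K₄` with detuning `δ`. -/
noncomputable def normalForm (δ J₁ J₂ φ₁ φ₂ : ℝ) : ℝ :=
  K0 J₁ J₂ + v.K2 δ J₁ J₂ φ₁ φ₂ + v.K4 δ J₁ J₂ φ₁ φ₂

/-- The one-degree-of-freedom Hamiltonian obtained by `J₁ = J`, `J₂ = E - J`, `ψ = φ₁ - φ₂`,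
`χ = φ₂`. The angle `χ` is cyclic, so it is put equal to `0`. -/
noncomputable def reduced (E δ J ψ : ℝ) : ℝ := v.normalForm δ J (E - J) ψ 0

/-- The planar Hamiltonian `𝓚(x, y; E, δ)`, obtained from the one-degree-of-freedom Hamiltonian by
`x = √(2J) cos ψ`, `y = √(2J) sin ψ`, that is, `J = (x² + y²) / 2` and `ψ = arg (x + i y)`.
The polynomial `r` in `x², y², E, δ` holds the higher order terms. -/
noncomputable def planar (r : MvPolynomial (Fin 4) ℝ) (E δ : ℝ) (p : ℝ × ℝ) : ℝ :=
  v.reduced E δ ((p.1 ^ 2 + p.2 ^ 2) / 2) (Complex.arg ⟨p.1, p.2⟩)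
    + MvPolynomial.eval ![p.1 ^ 2, p.2 ^ 2, E, δ] r

/-! ### Combinations of the coefficients and the central singularity -/

noncomputable def A : ℝ := 3 / 8 * (v.v40 + v.v04)
noncomputable def B : ℝ := 3 / 4 * (v.v40 - v.v04)
noncomputable def C : ℝ := 1 / 8 * v.v22

/-- `s_{i,j}` is the coefficient of `x ^ i * y ^ j` in the planar Hamiltonian at `E = δ = 0`;
see `planar_central`. -/
noncomputable def s40 : ℝ := v.A - 3 * v.C
noncomputable def s22 : ℝ := 2 * (v.A - 2 * v.C)
noncomputable def s04 : ℝ := v.A - v.C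
noncomputable def s60 : ℝ :=
  -17 / 9 * v.A * v.B + 17 / 3 * v.B * v.C + 5 / 16 * (v.v60 - v.v42 + v.v24 - v.v06)
noncomputable def s42 : ℝ :=
  -17 / 3 * v.A * v.B + 41 / 3 * v.B * v.C + 15 / 16 * (v.v60 - v.v06)
    + 11 / 16 * (v.v24 - v.v42)
noncomputable def s24 : ℝ :=
  -17 / 3 * v.A * v.B + 31 / 3 * v.B * v.C + 15 / 16 * (v.v60 - v.v06)
    + 7 / 16 * (v.v24 - v.v42)
noncomputable def s06 : ℝ :=
  -17 / 9 * v.A * v.B + 7 / 3 * v.B * v.C + 5 / 16 * (v.v60 - v.v06)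
    + 1 / 16 * (v.v24 - v.v42)

theorem planar_central (r : MvPolynomial (Fin 4) ℝ) (x y : ℝ) :
    v.planar r 0 0 (x, y) =
      v.s40 * x ^ 4 + v.s22 * x ^ 2 * y ^ 2 + v.s04 * y ^ 4
        + v.s60 * x ^ 6 + v.s42 * x ^ 4 * y ^ 2 + v.s24 * x ^ 2 * y ^ 4 + v.s06 * y ^ 6
        + MvPolynomial.eval ![x ^ 2, y ^ 2, 0, 0] r := by
  have key : (x ^ 2 + y ^ 2) * Real.cos (2 * Complex.arg ⟨x, y⟩) = x ^ 2 - y ^ 2 := by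
    have h1 := Complex.norm_mul_cos_arg (⟨x, y⟩ : ℂ)
    have h2 := Complex.sq_norm_sub_sq_re (⟨x, y⟩ : ℂ)
    simp only at h1 h2
    rw [Real.cos_two_mul]
    have h3 : x ^ 2 + y ^ 2 = ‖(⟨x, y⟩ : ℂ)‖ ^ 2 := by linarith
    calc _ = 2 * (‖(⟨x, y⟩ : ℂ)‖ * Real.cos (Complex.arg ⟨x, y⟩)) ^ 2 - (x ^ 2 + y ^ 2) := by
          rw [h3]; ring
      _ = _ := by rw [h1]; ring
  simp only [planar, reduced, normalForm, K0, K2, K4, s40, s22, s04, s60, s42, s24, s06, A, B, C,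
    mul_zero, sub_zero]
  generalize Real.cos (2 * Complex.arg ⟨x, y⟩) = c at key
  linear_combination ((x ^ 2 + y ^ 2) * (-1 / 8 * v.v22)
    + 1 / 32 * (x ^ 2 + y ^ 2) ^ 2 *
      ((4 * v.v24 - 2 * v.v22 ^ 2 - 5 * v.v22 * v.v04)
        - (4 * v.v42 - 2 * v.v22 ^ 2 - 5 * v.v22 * v.v40))) * key

noncomputable def ε₁ : ℝ := (v.A - 3 * v.C) / |v.A - 3 * v.C|
noncomputable def ε₂ : ℝ := (v.A - v.C) / |v.A - v.C|
noncomputable def μ : ℝ := 2 * (v.A - 2 * v.C) / √|(v.A - 3 * v.C) * (v.A - v.C)|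

/-- The central singularity `f`. -/
noncomputable def f (p : ℝ × ℝ) : ℝ :=
  v.ε₁ * p.1 ^ 4 + v.μ * p.1 ^ 2 * p.2 ^ 2 + v.ε₂ * p.2 ^ 4

/-- The scaling that normalizes the coefficients of `x⁴` and `y⁴` to `ε₁` and `ε₂`. -/
noncomputable def scaling (p : ℝ × ℝ) : ℝ × ℝ :=
  (p.1 / |v.A - 3 * v.C| ^ (1 / 4 : ℝ), p.2 / |v.A - v.C| ^ (1 / 4 : ℝ))

/-- `t_{i,j}` is the sextic coefficient `s_{i,j}` after the scaling. -/
noncomputable def t60 : ℝ := v.s60 / |v.A - 3 * v.C| ^ (3 / 2 : ℝ)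
noncomputable def t42 : ℝ := v.s42 / (|v.A - 3 * v.C| * |v.A - v.C| ^ (1 / 2 : ℝ))
noncomputable def t24 : ℝ := v.s24 / (|v.A - 3 * v.C| ^ (1 / 2 : ℝ) * |v.A - v.C|)
noncomputable def t06 : ℝ := v.s06 / |v.A - v.C| ^ (3 / 2 : ℝ)

/-- The explicit cubic coordinate change. -/
noncomputable def cubicMap (p : ℝ × ℝ) : ℝ × ℝ :=
  (p.1
    + (v.ε₁ * (2 * v.ε₂ * v.t24 - v.μ * v.t06) * v.μ + 2 * v.μ * v.t60 - 4 * v.ε₁ * v.t42)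
        / (4 * v.ε₁ * v.ε₂ * (4 * v.ε₁ * v.ε₂ - v.μ ^ 2)) * p.1 * p.2 ^ 2
    - v.t60 * v.ε₁ / 4 * p.1 ^ 3,
   p.2
    + (v.ε₂ * (2 * v.ε₁ * v.t42 - v.μ * v.t60) * v.μ + 2 * v.μ * v.t06 - 4 * v.ε₂ * v.t24)
        / (4 * v.ε₁ * v.ε₂ * (4 * v.ε₁ * v.ε₂ - v.μ ^ 2)) * p.1 ^ 2 * p.2
    - v.t06 * v.ε₂ / 4 * p.2 ^ 3)

/-! ### The coefficients `aᵢ` and the parameters `bᵢ` -/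

noncomputable def a1 : ℝ := (v.B - 2 * v.A + 6 * v.C) / √|3 * v.C - v.A|

noncomputable def a2 : ℝ :=
  (136 * v.A ^ 2 - 136 * v.A * v.B + 34 * v.B ^ 2 - 272 * v.A * v.C + 136 * v.B * v.C
    - 408 * v.C ^ 2 + 15 * v.v24 - 45 * v.v06) / (12 * √|3 * v.C - v.A|)

noncomputable def a3 : ℝ := (v.B - 2 * v.A + 2 * v.C) / √|v.C - v.A|

noncomputable def a4 : ℝ :=
  (136 * v.A ^ 2 - 136 * v.A * v.B + 34 * v.B ^ 2 - 112 * v.A * v.C + 56 * v.B * v.C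
    - 24 * v.C ^ 2 + 3 * v.v24 - 45 * v.v06) / (12 * √|v.C - v.A|)

noncomputable def a5 : ℝ :=
  -v.ε₁ / (288 * (v.A - 3 * v.C) ^ 2) *
    (1632 * v.A ^ 3 - 544 * v.A ^ 2 * (2 * v.B + 15 * v.C)
      + 2 * v.A * (68 * v.B ^ 2 + 3264 * v.B * v.C
        + 9 * (272 * v.C ^ 2 - 5 * (v.v60 + v.v42 - 3 * v.v24 + 5 * v.v06)))
      + 3 * (-136 * v.B ^ 2 * v.C
        - 3 * v.B * (1088 * v.C ^ 2 - 5 * (v.v60 - v.v42 + v.v24 - v.v06))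
        + 18 * v.C * (272 * v.C ^ 2 + 5 * (v.v60 + v.v42 - 3 * v.v24 + 5 * v.v06))))

noncomputable def a6 : ℝ :=
  v.ε₁ * v.ε₂ / (144 * |v.C - v.A| ^ (3 / 2 : ℝ) * |3 * v.C - v.A| ^ (3 / 2 : ℝ)) *
    (-1632 * v.A ^ 4 + 64 * v.A ^ 3 * (17 * v.B + 138 * v.C)
      - 2 * v.A ^ 2 * (68 * v.B ^ 2 + 3328 * v.B * v.C
        + 9 * (640 * v.C ^ 2 - 5 * v.v60 - 3 * v.v42 + 9 * v.v24 - 25 * v.v06))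
      + v.A * (512 * v.B ^ 2 * v.C
        - 72 * v.C * (48 * v.C ^ 2 + 5 * v.v60 + 2 * v.v42 - 8 * v.v24 + 25 * v.v06)
        + v.B * (12608 * v.C ^ 2 - 45 * v.v60 + 27 * v.v42 - 27 * v.v24 + 45 * v.v06))
      - 6 * v.C * (52 * v.B ^ 2 * v.C
        + v.B * (1216 * v.C ^ 2 - 15 * v.v60 + 6 * v.v42 - 6 * v.v24 + 15 * v.v06)
        - 3 * v.C * (432 * v.C ^ 2 + 5 * v.v60 + 7 * v.v42 - 25 * v.v24 + 85 * v.v06)))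

noncomputable def a7 : ℝ :=
  -v.ε₂ / (288 * (v.A - v.C) ^ 2) *
    (1632 * v.A ^ 3 - 32 * v.A ^ 2 * (34 * v.B + 93 * v.C)
      + 2 * v.A * (68 * v.B ^ 2 + 1216 * v.B * v.C + 528 * v.C ^ 2
        - 225 * v.v06 + 27 * v.v24 - 9 * v.v42 - 45 * v.v60)
      + 3 * (-24 * v.B ^ 2 * v.C
        - v.B * (448 * v.C ^ 2 + 3 * (5 * v.v06 - v.v24 + v.v42 - 5 * v.v60))
        + 6 * v.C * (16 * v.C ^ 2 + 25 * v.v06 - 3 * v.v24 + v.v42 + 5 * v.v60)))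

noncomputable def b1 (δ : ℝ) : ℝ := -(6 * v.C * δ) / √|3 * v.C - v.A|

noncomputable def b2 (δ : ℝ) : ℝ := δ / (2 * √|3 * v.C - v.A|)

noncomputable def b3 (δ : ℝ) : ℝ := -(2 * v.C * δ) / √|v.C - v.A|

noncomputable def b4 (δ : ℝ) : ℝ := δ / (2 * √|v.C - v.A|)

noncomputable def b5 (δ : ℝ) : ℝ :=
  -v.ε₁ *
    (576 * v.A ^ 2 + 16 * v.A * v.B - 3456 * v.A * v.C - 48 * v.B * v.C + 5184 * v.C ^ 2
      + 45 * (v.v60 - v.v42 + v.v24 - v.v06)) * δ / (576 * (v.A - 3 * v.C) ^ 2)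

noncomputable def b6 (δ : ℝ) : ℝ :=
  v.ε₁ * v.ε₂ *
    (-576 * v.A ^ 3 - 16 * v.A ^ 2 * v.B + 3456 * v.A ^ 2 * v.C + 32 * v.A * v.B * v.C
      - 6336 * v.A * v.C ^ 2 + 48 * v.B * v.C ^ 2 + 3456 * v.C ^ 3
      - 45 * v.A * v.v60 + 90 * v.C * v.v60 + 27 * v.A * v.v42 - 36 * v.C * v.v42
      - 27 * v.A * v.v24 + 36 * v.C * v.v24 + 45 * v.A * v.v06 - 90 * v.C * v.v06)
    * (δ / (288 * |v.C - v.A| ^ (3 / 2 : ℝ) * |3 * v.C - v.A| ^ (3 / 2 : ℝ)))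

noncomputable def b7 (δ : ℝ) : ℝ :=
  -v.ε₂ *
    (576 * v.A ^ 2 + 16 * v.A * (v.B - 72 * v.C) + 48 * v.B * v.C
      + 9 * (64 * v.C ^ 2 + 5 * v.v60 - v.v42 + v.v24 - 5 * v.v06)) * δ
    / (576 * (v.A - v.C) ^ 2)

/-- The quartic form `𝓚_b` without its higher order terms. -/
noncomputable def Kb (E δ : ℝ) (p : ℝ × ℝ) : ℝ :=
  (v.a1 * E + v.a2 * E ^ 2 + v.b1 δ * E + v.b2 δ) * p.1 ^ 2
    + (v.a3 * E + v.a4 * E ^ 2 + v.b3 δ * E + v.b4 δ) * p.2 ^ 2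
    + (v.ε₁ + v.a5 * E + v.b5 δ) * p.1 ^ 4
    + (v.μ + v.a6 * E + v.b6 δ) * p.1 ^ 2 * p.2 ^ 2
    + (v.ε₂ + v.a7 * E + v.b7 δ) * p.2 ^ 4

/-- `𝓚 ∘ Φ`, up to the constant term of `𝓚`, equals the quartic form up to higher order terms:
terms of degree at least eight, where `x, y` have degree one and `E, δ` have degree two. -/
def HasFormKb (r : MvPolynomial (Fin 4) ℝ) (Φ : ℝ × ℝ → ℝ × ℝ) : Prop :=
  (fun q : (ℝ × ℝ) × ℝ × ℝ =>
      v.planar r q.2.1 q.2.2 (Φ q.1) - v.planar r q.2.1 q.2.2 0 - v.Kb q.2.1 q.2.2 q.1)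
    =O[𝓝 0] fun q => (q.1.1 ^ 2 + q.1.2 ^ 2 + |q.2.1| + |q.2.2|) ^ 4

end Potential

end Resonance22

/-- The restriction of a polynomial without terms of degree less than four to the first two
variables lies in the ideal `𝔪 · (X ^ 3, X ^ 2 * Y, X * Y ^ 2, Y ^ 3)`. -/
theorem MvPolynomial.exists_eval_eq_cubic_combination (r : MvPolynomial (Fin 4) ℝ)
    (hr : ∀ m ∈ r.support, 4 ≤ m.degree) (a b : ℝ) :
    ∃ R₀ R₁ R₂ R₃ : ℝ × ℝ → ℝ,
      (ContDiff ℝ ω R₀ ∧ ContDiff ℝ ω R₁ ∧ ContDiff ℝ ω R₂ ∧ ContDiff ℝ ω R₃) ∧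
      (R₀ 0 = 0 ∧ R₁ 0 = 0 ∧ R₂ 0 = 0 ∧ R₃ 0 = 0) ∧
      ∀ w : ℝ × ℝ, MvPolynomial.eval ![a * w.1, b * w.2, 0, 0] r =
        w.1 ^ 3 * R₀ w + w.1 ^ 2 * w.2 * R₁ w + w.1 * w.2 ^ 2 * R₂ w + w.2 ^ 3 * R₃ w := by
  have monomial : ∀ (c : ℝ) (i j : ℕ), 4 ≤ i + j → ∃ R₀ R₁ R₂ R₃ : ℝ × ℝ → ℝ,
      (ContDiff ℝ ω R₀ ∧ ContDiff ℝ ω R₁ ∧ ContDiff ℝ ω R₂ ∧ ContDiff ℝ ω R₃) ∧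
      (R₀ 0 = 0 ∧ R₁ 0 = 0 ∧ R₂ 0 = 0 ∧ R₃ 0 = 0) ∧
      ∀ w : ℝ × ℝ, c * ((a * w.1) ^ i * (b * w.2) ^ j) =
        w.1 ^ 3 * R₀ w + w.1 ^ 2 * w.2 * R₁ w + w.1 * w.2 ^ 2 * R₂ w + w.2 ^ 3 * R₃ w := by
    intro c i j hij
    rcases Nat.lt_or_ge i 3 with hi | hi
    · interval_cases i
      · obtain ⟨k, rfl⟩ : ∃ k, j = 3 + (k + 1) := ⟨j - 4, by omega⟩
        exact ⟨0, 0, 0, fun w => c * b ^ (3 + (k + 1)) * w.2 ^ (k + 1),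
          ⟨contDiff_const, contDiff_const, contDiff_const, by fun_prop⟩,
          ⟨rfl, rfl, rfl, by simp⟩, fun w => by simp; ring⟩
      · obtain ⟨k, rfl⟩ : ∃ k, j = 2 + (k + 1) := ⟨j - 3, by omega⟩
        exact ⟨0, 0, fun w => c * a * b ^ (2 + (k + 1)) * w.2 ^ (k + 1), 0,
          ⟨contDiff_const, contDiff_const, by fun_prop, contDiff_const⟩,
          ⟨rfl, rfl, by simp, rfl⟩, fun w => by simp; ring⟩
      · obtain ⟨k, rfl⟩ : ∃ k, j = 1 + (k + 1) := ⟨j - 2, by omega⟩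
        exact ⟨0, fun w => c * a ^ 2 * b ^ (1 + (k + 1)) * w.2 ^ (k + 1), 0, 0,
          ⟨contDiff_const, by fun_prop, contDiff_const, contDiff_const⟩,
          ⟨rfl, by simp, rfl, rfl⟩, fun w => by simp; ring⟩
    · obtain ⟨k, rfl⟩ : ∃ k, i = 3 + k := ⟨i - 3, by omega⟩
      refine ⟨fun w => c * a ^ (3 + k) * b ^ j * (w.1 ^ k * w.2 ^ j), 0, 0, 0,
          ⟨by fun_prop, contDiff_const, contDiff_const, contDiff_const⟩,
          ⟨?_, rfl, rfl, rfl⟩, fun w => by simp; ring⟩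
      rcases Nat.eq_zero_or_pos k with rfl | hk
      · have : j ≠ 0 := by omega
        simp [this]
      · simp [hk.ne']
  have sum : ∀ s ⊆ r.support, ∃ R₀ R₁ R₂ R₃ : ℝ × ℝ → ℝ,
      (ContDiff ℝ ω R₀ ∧ ContDiff ℝ ω R₁ ∧ ContDiff ℝ ω R₂ ∧ ContDiff ℝ ω R₃) ∧
      (R₀ 0 = 0 ∧ R₁ 0 = 0 ∧ R₂ 0 = 0 ∧ R₃ 0 = 0) ∧
      ∀ w : ℝ × ℝ,
        ∑ m ∈ s, r.coeff m * ∏ i, (![a * w.1, b * w.2, 0, 0] : Fin 4 → ℝ) i ^ m i =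
        w.1 ^ 3 * R₀ w + w.1 ^ 2 * w.2 * R₁ w + w.1 * w.2 ^ 2 * R₂ w + w.2 ^ 3 * R₃ w := by
    intro s
    induction s using Finset.induction_on with
    | empty =>
      exact fun _ => ⟨0, 0, 0, 0, ⟨contDiff_const, contDiff_const, contDiff_const, contDiff_const⟩,
        ⟨rfl, rfl, rfl, rfl⟩, fun w => by simp⟩
    | insert m s hm ih =>
      intro hs
      obtain ⟨S₀, S₁, S₂, S₃, ⟨c₀, c₁, c₂, c₃⟩, ⟨z₀, z₁, z₂, z₃⟩, hS⟩ :=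
        ih ((Finset.subset_insert m s).trans hs)
      have hdeg := hr m (hs (Finset.mem_insert_self m s))
      rw [Finsupp.degree_eq_sum, Fin.sum_univ_four] at hdeg
      by_cases h : m 2 = 0 ∧ m 3 = 0
      · obtain ⟨T₀, T₁, T₂, T₃, ⟨d₀, d₁, d₂, d₃⟩, ⟨y₀, y₁, y₂, y₃⟩, hT⟩ :=
          monomial (r.coeff m) (m 0) (m 1) (by omega)
        refine ⟨S₀ + T₀, S₁ + T₁, S₂ + T₂, S₃ + T₃,
          ⟨c₀.add d₀, c₁.add d₁, c₂.add d₂, c₃.add d₃⟩, by simp [*], fun w => ?_⟩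
        rw [Finset.sum_insert hm, hS, Fin.prod_univ_four]
        simp only [h.1, h.2, pow_zero, mul_one, Matrix.cons_val, Pi.add_apply]
        rw [hT]
        ring
      · refine ⟨S₀, S₁, S₂, S₃, ⟨c₀, c₁, c₂, c₃⟩, ⟨z₀, z₁, z₂, z₃⟩, fun w => ?_⟩
        rw [Finset.sum_insert hm, hS, Fin.prod_univ_four]
        rcases not_and_or.1 h with h | h <;> simp [h]
  obtain ⟨R₀, R₁, R₂, R₃, h, h', H⟩ := sum r.support subset_rfl
  exact ⟨R₀, R₁, R₂, R₃, h, h', fun w => by rw [MvPolynomial.eval_eq', H]⟩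

/-- Higher order terms of a planar function in the squares of the coordinates can be removed by a
change of coordinates that preserves the axes. -/
theorem exists_axis_preserving_normalization {e₁ m e₂ α β γ κ : ℝ} (he₁ : e₁ ≠ 0) (he₂ : e₂ ≠ 0)
    (hm : 4 * e₁ * e₂ - m ^ 2 ≠ 0) {R₀ R₁ R₂ R₃ : ℝ × ℝ → ℝ}
    (hR₀ : ContDiff ℝ ω R₀) (hR₁ : ContDiff ℝ ω R₁) (hR₂ : ContDiff ℝ ω R₂)
    (hR₃ : ContDiff ℝ ω R₃)
    (h₀ : R₀ 0 + 4 * e₁ * α = 0)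
    (h₁ : R₁ 0 + 4 * e₁ * β + 2 * m * (α + γ) = 0)
    (h₂ : R₂ 0 + 2 * m * (β + κ) + 4 * e₂ * γ = 0)
    (h₃ : R₃ 0 + 4 * e₂ * κ = 0) :
    ∃ z : ℝ × ℝ → ℝ × ℝ × ℝ × ℝ, ContDiffAt ℝ ω z 0 ∧ z 0 = (α, β, γ, κ) ∧
      ∀ᶠ w in 𝓝 (0 : ℝ × ℝ), ∀ X Y : ℝ,
        X = w.1 * (1 + (w.1 * (z w).1 + w.2 * (z w).2.1)) ^ 2 →
        Y = w.2 * (1 + (w.1 * (z w).2.2.1 + w.2 * (z w).2.2.2)) ^ 2 →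
        e₁ * X ^ 2 + m * (X * Y) + e₂ * Y ^ 2 + (X ^ 3 * R₀ (X, Y) + X ^ 2 * Y * R₁ (X, Y)
          + X * Y ^ 2 * R₂ (X, Y) + Y ^ 3 * R₃ (X, Y))
        = e₁ * w.1 ^ 2 + m * (w.1 * w.2) + e₂ * w.2 ^ 2 := by
  let p : (ℝ × ℝ) × (ℝ × ℝ × ℝ × ℝ) → ℝ := fun u => u.1.1 * u.2.1 + u.1.2 * u.2.2.1
  let s : (ℝ × ℝ) × (ℝ × ℝ × ℝ × ℝ) → ℝ := fun u => u.1.1 * u.2.2.2.1 + u.1.2 * u.2.2.2.2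
  let T : (ℝ × ℝ) × (ℝ × ℝ × ℝ × ℝ) → ℝ × ℝ := fun u =>
    (u.1.1 * (1 + p u) ^ 2, u.1.2 * (1 + s u) ^ 2)
  let F : (ℝ × ℝ) × (ℝ × ℝ × ℝ × ℝ) → ℝ × ℝ × ℝ × ℝ := fun u =>
    (e₁ * (4 + 6 * p u + 4 * p u ^ 2 + p u ^ 3) * u.2.1 + (1 + p u) ^ 6 * R₀ (T u),
     e₁ * (4 + 6 * p u + 4 * p u ^ 2 + p u ^ 3) * u.2.2.1
      + m * ((2 + p u) * u.2.1 + (1 + p u) ^ 2 * (2 + s u) * u.2.2.2.1)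
      + (1 + p u) ^ 4 * (1 + s u) ^ 2 * R₁ (T u),
     e₂ * (4 + 6 * s u + 4 * s u ^ 2 + s u ^ 3) * u.2.2.2.1
      + m * ((2 + p u) * u.2.2.1 + (1 + p u) ^ 2 * (2 + s u) * u.2.2.2.2)
      + (1 + p u) ^ 2 * (1 + s u) ^ 4 * R₂ (T u),
     e₂ * (4 + 6 * s u + 4 * s u ^ 2 + s u ^ 3) * u.2.2.2.2 + (1 + s u) ^ 6 * R₃ (T u))
  have hp : ContDiff ℝ ω p := by fun_prop
  have hs : ContDiff ℝ ω s := by fun_prop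
  have hT : ContDiff ℝ ω T := by fun_prop
  have hF : ContDiff ℝ ω F := by fun_prop
  let u₀ : (ℝ × ℝ) × (ℝ × ℝ × ℝ × ℝ) := (0, (α, β, γ, κ))
  have hFu : F u₀ = 0 := by
    have hT0 : T u₀ = 0 := by simp [T, u₀]
    simp only [F, hT0]
    simp only [p, s, u₀, Prod.fst_zero, Prod.snd_zero, zero_mul, add_zero, Prod.mk_eq_zero]
    exact ⟨by linear_combination h₀, by linear_combination h₁, by linear_combination h₂,
      by linear_combination h₃⟩
  have hω : (ω : WithTop ℕ∞) ≠ 0 := by simp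
  have hFat : ContDiffAt ℝ ω F u₀ := hF.contDiffAt
  have hinv : (fderiv ℝ F u₀ ∘L .inr ℝ (ℝ × ℝ) (ℝ × ℝ × ℝ × ℝ)).IsInvertible := by
    have hslice : HasFDerivAt (fun z : ℝ × ℝ × ℝ × ℝ => F (0, z))
        (fderiv ℝ F u₀ ∘L .inr ℝ (ℝ × ℝ) (ℝ × ℝ × ℝ × ℝ)) (α, β, γ, κ) :=
      ((hF.differentiable hω) u₀).hasFDerivAt.comp _ (hasFDerivAt_prodMk_right _ _)
    have hlin : ∀ k : ℝ × ℝ × ℝ × ℝ,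
        (fderiv ℝ F u₀ ∘L .inr ℝ (ℝ × ℝ) (ℝ × ℝ × ℝ × ℝ)) k =
          (4 * e₁ * k.1, 4 * e₁ * k.2.1 + 2 * m * (k.1 + k.2.2.1),
            4 * e₂ * k.2.2.1 + 2 * m * (k.2.1 + k.2.2.2), 4 * e₂ * k.2.2.2) := by
      intro k
      have hline := hslice.hasLineDerivAt k
      refine hline.unique ?_
      have : (fun t : ℝ => F (0, (α, β, γ, κ) + t • k)) = fun t : ℝ =>
          ((0, 0, 0, 0) : ℝ × ℝ × ℝ × ℝ) + t •
          (4 * e₁ * k.1, 4 * e₁ * k.2.1 + 2 * m * (k.1 + k.2.2.1),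
            4 * e₂ * k.2.2.1 + 2 * m * (k.2.1 + k.2.2.2), 4 * e₂ * k.2.2.2) := by
        funext t
        have hT0 : T (0, (α, β, γ, κ) + t • k) = 0 := by simp [T]
        simp only [F, hT0]
        simp only [p, s, Prod.fst_zero, Prod.snd_zero, zero_mul, add_zero, Prod.smul_fst,
          Prod.smul_snd, Prod.fst_add, Prod.snd_add, smul_eq_mul, Prod.smul_mk, Prod.mk_add_mk,
          Prod.mk.injEq]
        exact ⟨by linear_combination h₀, by linear_combination h₁, by linear_combination h₂,
          by linear_combination h₃⟩
      unfold HasLineDerivAt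
      rw [this]
      simpa using ((hasDerivAt_id (0 : ℝ)).smul_const
        ((4 * e₁ * k.1, 4 * e₁ * k.2.1 + 2 * m * (k.1 + k.2.2.1),
            4 * e₂ * k.2.2.1 + 2 * m * (k.2.1 + k.2.2.2), 4 * e₂ * k.2.2.2) :
              ℝ × ℝ × ℝ × ℝ)).const_add ((0, 0, 0, 0) : ℝ × ℝ × ℝ × ℝ)
    set M := fderiv ℝ F u₀ ∘L .inr ℝ (ℝ × ℝ) (ℝ × ℝ × ℝ × ℝ)
    have hinj : Function.Injective M.toLinearMap := by
      rw [injective_iff_map_eq_zero]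
      rintro ⟨k₁, k₂, k₃, k₄⟩ hk
      have hk' := (hlin (k₁, k₂, k₃, k₄)).symm.trans hk
      simp only [Prod.mk_eq_zero] at hk'
      obtain ⟨q₁, q₂, q₃, q₄⟩ := hk'
      have z₁ : k₁ = 0 := by simpa [he₁] using q₁
      have z₄ : k₄ = 0 := by simpa [he₂] using q₄
      subst z₁ z₄
      have z₂ : (4 * e₁ * e₂ - m ^ 2) * k₂ = 0 := by linear_combination e₂ * q₂ - m / 2 * q₃
      have z₃ : (4 * e₁ * e₂ - m ^ 2) * k₃ = 0 := by linear_combination e₁ * q₃ - m / 2 * q₂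
      simp only [mul_eq_zero, hm, false_or] at z₂ z₃
      simp [z₂, z₃]
    refine ⟨(LinearEquiv.ofInjectiveEndo M.toLinearMap hinj).toContinuousLinearEquiv, ?_⟩
    ext <;> rfl
  refine ⟨hFat.implicitFunction hω hinv, hFat.contDiffAt_implicitFunction hω hinv,
    hFat.implicitFunction_apply_self hω hinv, ?_⟩
  have hev : ∀ᶠ w in 𝓝 (0 : ℝ × ℝ), F (w, hFat.implicitFunction hω hinv w) = F u₀ :=
    hFat.eventually_apply_implicitFunction hω hinv
  filter_upwards [hev] with w hw X Y hX hY
  rw [hFu] at hw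
  generalize hFat.implicitFunction hω hinv w = z at *
  have hTw : T (w, z) = (X, Y) := by rw [hX, hY]
  simp only [F, Prod.mk_eq_zero, hTw] at hw
  obtain ⟨g₀, g₁, g₂, g₃⟩ := hw
  generalize R₀ (X, Y) = r₀ at *
  generalize R₁ (X, Y) = r₁ at *
  generalize R₂ (X, Y) = r₂ at *
  generalize R₃ (X, Y) = r₃ at *
  simp only [p, s] at g₀ g₁ g₂ g₃
  subst hX hY
  linear_combination w.1 ^ 3 * g₀ + w.1 ^ 2 * w.2 * g₁ + w.1 * w.2 ^ 2 * g₂ + w.2 ^ 3 * g₃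

/-- The map `(x, y) ↦ (x (1 + x² z₁ + y² z₂), y (1 + x² z₃ + y² z₄))`, where the `zᵢ` are functions
of the squares `x²` and `y²`. -/
def reflectionEquivariantMap (z : ℝ × ℝ → ℝ × ℝ × ℝ × ℝ) (p : ℝ × ℝ) : ℝ × ℝ :=
  (p.1 * (1 + (p.1 ^ 2 * (z (p.1 ^ 2, p.2 ^ 2)).1 + p.2 ^ 2 * (z (p.1 ^ 2, p.2 ^ 2)).2.1)),
   p.2 * (1 + (p.1 ^ 2 * (z (p.1 ^ 2, p.2 ^ 2)).2.2.1 + p.2 ^ 2 * (z (p.1 ^ 2, p.2 ^ 2)).2.2.2)))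

theorem exists_diffeo_eq_reflectionEquivariantMap {z : ℝ × ℝ → ℝ × ℝ × ℝ × ℝ}
    (hz : ContDiffAt ℝ ω z 0) :
    ∃ φ : OpenPartialHomeomorph (ℝ × ℝ) (ℝ × ℝ),
      ((0 : ℝ × ℝ) ∈ φ.source ∧ φ 0 = 0 ∧
        ContDiffOn ℝ ∞ φ φ.source ∧ ContDiffOn ℝ ∞ φ.symm φ.target) ∧
      (∀ p ∈ φ.source,
        ((-p.1, p.2) ∈ φ.source ∧ φ (-p.1, p.2) = (-(φ p).1, (φ p).2)) ∧
        ((p.1, -p.2) ∈ φ.source ∧ φ (p.1, -p.2) = ((φ p).1, -(φ p).2))) ∧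
      ∀ p, φ p = reflectionEquivariantMap z p := by
  set g := reflectionEquivariantMap z with hg
  have hg0 : g 0 = 0 := by simp [hg, reflectionEquivariantMap]
  have hsq : ContDiffAt ℝ ω (fun p : ℝ × ℝ => z (p.1 ^ 2, p.2 ^ 2)) 0 := by
    refine ContDiffAt.comp (g := z) (f := fun p : ℝ × ℝ => (p.1 ^ 2, p.2 ^ 2)) 0 ?_ (by fun_prop)
    simpa [← Prod.zero_eq_mk] using hz
  have hc : ContDiffAt ℝ ω g 0 := by
    obtain ⟨Z, hZ⟩ : ∃ Z : ℝ × ℝ → ℝ × ℝ × ℝ × ℝ, Z = fun p => z (p.1 ^ 2, p.2 ^ 2) := ⟨_, rfl⟩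
    have hgZ : g = fun p => (p.1 * (1 + (p.1 ^ 2 * (Z p).1 + p.2 ^ 2 * (Z p).2.1)),
        p.2 * (1 + (p.1 ^ 2 * (Z p).2.2.1 + p.2 ^ 2 * (Z p).2.2.2))) := by
      rw [hZ, hg]; rfl
    rw [← hZ] at hsq
    rw [hgZ]
    fun_prop
  have hω : (ω : WithTop ℕ∞) ≠ 0 := by simp
  have hd : HasFDerivAt g ((ContinuousLinearEquiv.refl ℝ (ℝ × ℝ) : ℝ × ℝ →L[ℝ] ℝ × ℝ)) 0 := by
    have h1 := (hc.differentiableAt hω).hasFDerivAt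
    have hlin : ∀ k : ℝ × ℝ, fderiv ℝ g 0 k = k := by
      intro k
      obtain ⟨Z, hZ⟩ : ∃ Z : ℝ → ℝ × ℝ × ℝ × ℝ,
          Z = fun t => z ((t * k.1) ^ 2, (t * k.2) ^ 2) := ⟨_, rfl⟩
      have hcont : ContinuousAt Z 0 := by
        rw [hZ]
        refine ContinuousAt.comp (g := z) (f := fun t : ℝ => ((t * k.1) ^ 2, (t * k.2) ^ 2))
          ?_ (by fun_prop)
        simpa [← Prod.zero_eq_mk] using hz.continuousAt
      have hline := h1.hasLineDerivAt k
      refine hline.unique ?_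
      unfold HasLineDerivAt
      have key : ∀ {u : ℝ → ℝ} (c : ℝ), ContinuousAt u 0 → u 0 = 0 →
          HasDerivAt (fun t : ℝ => t * c * (1 + u t)) c 0 := by
        intro u c hu hu0
        have : HasDerivAt (fun t : ℝ => t * (1 + u t)) 1 0 := by
          rw [hasDerivAt_iff_tendsto_slope]
          have h2 : Tendsto (fun t => 1 + u t) (𝓝[≠] 0) (𝓝 1) := by
            have : Tendsto (fun t => 1 + u t) (𝓝 0) (𝓝 (1 + u 0)) := hu.const_add 1
            rw [hu0, add_zero] at this
            exact this.mono_left nhdsWithin_le_nhds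
          refine h2.congr' ?_
          filter_upwards [self_mem_nhdsWithin] with t (ht : t ≠ 0)
          simp [slope_def_field, ht]
        have h3 := this.mul_const c
        rw [one_mul] at h3
        exact h3.congr_of_eventuallyEq (Eventually.of_forall fun t => by ring)
      have e1 := key (u := fun t => (t * k.1) ^ 2 * (Z t).1 + (t * k.2) ^ 2 * (Z t).2.1) k.1
        (by fun_prop) (by simp)
      have e2 := key (u := fun t => (t * k.1) ^ 2 * (Z t).2.2.1 + (t * k.2) ^ 2 * (Z t).2.2.2) k.2
        (by fun_prop) (by simp)
      simpa [hg, hZ, reflectionEquivariantMap] using e1.prodMk e2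
    have : fderiv ℝ g 0 = ((ContinuousLinearEquiv.refl ℝ (ℝ × ℝ) : ℝ × ℝ →L[ℝ] ℝ × ℝ)) :=
      ContinuousLinearMap.ext hlin
    rwa [this] at h1
  let e := hc.toOpenPartialHomeomorph g hd hω
  have he : ∀ p, e p = g p := fun _ => rfl
  have he0 : (0 : ℝ × ℝ) ∈ e.source := hc.mem_toOpenPartialHomeomorph_source hd hω
  have hsymm : ContDiffAt ℝ ω e.symm 0 := by
    have := hc.to_localInverse hd hω
    rwa [hg0] at this
  have hev : ∀ᶠ p in 𝓝 (0 : ℝ × ℝ),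
      p ∈ e.source ∧ ContDiffAt ℝ ω g p ∧ ContDiffAt ℝ ω e.symm (g p) := by
    refine (e.open_source.eventually_mem he0).and ((hc.eventually (by simp)).and ?_)
    have h2 := hsymm.eventually (by simp)
    have hct : Tendsto g (𝓝 0) (𝓝 0) := by
      simpa [hg0] using hc.continuousAt.tendsto
    exact hct.eventually h2
  obtain ⟨η, hη, hball⟩ := Metric.eventually_nhds_iff_ball.1 hev
  let φ := e.restrOpen (Metric.ball 0 η) Metric.isOpen_ball
  have hφs : φ.source = Metric.ball 0 η := by
    rw [OpenPartialHomeomorph.restrOpen_source]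
    exact Set.inter_eq_right.2 fun p hp => (hball p hp).1
  have hφ : ∀ p, φ p = g p := fun _ => rfl
  refine ⟨φ, ⟨?_, by rw [hφ, hg0], ?_, ?_⟩, ?_, hφ⟩
  · rw [hφs]; exact Metric.mem_ball_self hη
  · rw [hφs]
    exact fun p hp => ((hball p hp).2.1.of_le (by simp)).contDiffWithinAt
  · intro y hy
    have hx := φ.map_target hy
    have hyx : g (φ.symm y) = y := φ.right_inv hy
    rw [hφs] at hx
    have := (hball _ hx).2.2
    rw [hyx] at this
    exact (this.of_le (by simp)).contDiffWithinAt
  · intro p hp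
    rw [hφs] at hp ⊢
    refine ⟨⟨?_, ?_⟩, ?_, ?_⟩
    · simpa [Prod.norm_def] using hp
    · simp [hφ, hg, reflectionEquivariantMap]
    · simpa [Prod.norm_def] using hp
    · simp [hφ, hg, reflectionEquivariantMap]

/-- A reflection equivariant map agrees up to terms of order five with its cubic Taylor
polynomial. -/
theorem reflectionEquivariantMap_sub_cubic_isBigO {z : ℝ × ℝ → ℝ × ℝ × ℝ × ℝ}
    (hz : DifferentiableAt ℝ z 0) :
    (fun p : ℝ × ℝ => reflectionEquivariantMap z p - reflectionEquivariantMap (fun _ => z 0) p)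
      =O[𝓝 0] fun p => ‖p‖ ^ 5 := by
  have hfst : (fun p : ℝ × ℝ => p.1) =O[𝓝 0] fun p => ‖p‖ :=
    .of_norm_le fun p => norm_fst_le p
  have hsnd : (fun p : ℝ × ℝ => p.2) =O[𝓝 0] fun p => ‖p‖ :=
    .of_norm_le fun p => norm_snd_le p
  have hsq : Tendsto (fun p : ℝ × ℝ => (p.1 ^ 2, p.2 ^ 2)) (𝓝 0) (𝓝 0) := by
    have : Continuous fun p : ℝ × ℝ => (p.1 ^ 2, p.2 ^ 2) := by fun_prop
    simpa [← Prod.zero_eq_mk] using this.tendsto 0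
  have hz2 : (fun p : ℝ × ℝ => z (p.1 ^ 2, p.2 ^ 2) - z 0) =O[𝓝 0] fun p => ‖p‖ ^ 2 := by
    have h1 : (fun w : ℝ × ℝ => z w - z 0) =O[𝓝 0] fun w => w := by
      simpa using hz.isBigO_sub
    refine (h1.comp_tendsto hsq).trans ?_
    exact (hfst.pow 2).prod_left (hsnd.pow 2)
  have hc : ∀ {u : ℝ × ℝ → ℝ}, (∀ p, ‖u p‖ ≤ ‖z (p.1 ^ 2, p.2 ^ 2) - z 0‖) →
      u =O[𝓝 0] fun p => ‖p‖ ^ 2 := fun h => (IsBigO.of_norm_le h).trans hz2.norm_left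
  have c1 := hc (u := fun p => (z (p.1 ^ 2, p.2 ^ 2) - z 0).1) fun p => norm_fst_le _
  have c2 := hc (u := fun p => (z (p.1 ^ 2, p.2 ^ 2) - z 0).2.1) fun p =>
    (norm_fst_le _).trans (norm_snd_le _)
  have c3 := hc (u := fun p => (z (p.1 ^ 2, p.2 ^ 2) - z 0).2.2.1) fun p =>
    ((norm_fst_le _).trans (norm_snd_le _)).trans (norm_snd_le _)
  have c4 := hc (u := fun p => (z (p.1 ^ 2, p.2 ^ 2) - z 0).2.2.2) fun p =>
    ((norm_snd_le _).trans (norm_snd_le _)).trans (norm_snd_le _)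
  have d1 := hfst.mul (((hfst.pow 2).mul c1).add ((hsnd.pow 2).mul c2))
  have d2 := hsnd.mul (((hfst.pow 2).mul c3).add ((hsnd.pow 2).mul c4))
  refine IsBigO.prod_left ?_ ?_
  · refine (d1.congr_right fun p => by ring).congr_left fun p => ?_
    simp only [reflectionEquivariantMap, Prod.fst_sub, Prod.snd_sub]
    ring
  · refine (d2.congr_right fun p => by ring).congr_left fun p => ?_
    simp only [reflectionEquivariantMap, Prod.fst_sub, Prod.snd_sub]
    ring

namespace Resonance22.Potential

variable (v : Potential)

/-- The part of the planar Hamiltonian that is quadratic in `U = x²`, `V = y²`, `E`, `δ`. -/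
noncomputable def quadraticPart (E δ U V : ℝ) : ℝ :=
  δ * ((U + V) / 2) + 3 / 2 * v.v40 * ((U + V) / 2) ^ 2
    + 3 / 2 * v.v04 * (E - (U + V) / 2) ^ 2
    + 1 / 2 * v.v22 * (E - (U + V) / 2) * ((3 * U + V) / 2)

/-- The part of the planar Hamiltonian that is cubic in `U = x²`, `V = y²`, `E`, `δ`. -/
noncomputable def cubicPart (E δ U V : ℝ) : ℝ :=
  -3 * v.v40 * (δ * ((U + V) / 2) * ((U + V) / 2))
    - 1 / 2 * v.v22 * (δ * (E - (U + V) / 2) * ((3 * U + V) / 2))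
    + 1 / 4 * (10 * v.v60 - 17 * v.v40 ^ 2) * ((U + V) / 2 * ((U + V) / 2) * ((U + V) / 2))
    + 1 / 4 * (10 * v.v06 - 17 * v.v04 ^ 2) *
      ((E - (U + V) / 2) * (E - (U + V) / 2) * (E - (U + V) / 2))
    + 1 / 4 * ((U + V) / 2 * (E - (U + V) / 2) *
      ((6 * v.v42 - 9 / 4 * v.v22 ^ 2 - 12 * v.v22 * v.v40) * ((U + V) / 2)
        + (4 * v.v42 - 2 * v.v22 ^ 2 - 5 * v.v22 * v.v40) * ((U - V) / 2)))
    + 1 / 4 * ((E - (U + V) / 2) * (E - (U + V) / 2) *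
      ((6 * v.v24 - 9 / 4 * v.v22 ^ 2 - 12 * v.v22 * v.v04) * ((U + V) / 2)
        + (4 * v.v24 - 2 * v.v22 ^ 2 - 5 * v.v22 * v.v04) * ((U - V) / 2)))

theorem sq_add_sq_mul_cos_two_mul_arg (x y : ℝ) :
    (x ^ 2 + y ^ 2) * Real.cos (2 * Complex.arg ⟨x, y⟩) = x ^ 2 - y ^ 2 := by
  have h1 := Complex.norm_mul_cos_arg (⟨x, y⟩ : ℂ)
  have h2 := Complex.sq_norm_sub_sq_re (⟨x, y⟩ : ℂ)
  simp only at h1 h2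
  rw [Real.cos_two_mul]
  linear_combination -2 * Real.cos (Complex.arg ⟨x, y⟩) ^ 2 * h2
    + 2 * (‖(⟨x, y⟩ : ℂ)‖ * Real.cos (Complex.arg ⟨x, y⟩) + x) * h1

theorem planar_eq (r : MvPolynomial (Fin 4) ℝ) (E δ : ℝ) (p : ℝ × ℝ) :
    v.planar r E δ p = E + v.quadraticPart E δ (p.1 ^ 2) (p.2 ^ 2)
      + v.cubicPart E δ (p.1 ^ 2) (p.2 ^ 2)
      + MvPolynomial.eval ![p.1 ^ 2, p.2 ^ 2, E, δ] r := by
  obtain ⟨x, y⟩ := p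
  have key := sq_add_sq_mul_cos_two_mul_arg x y
  simp only [planar, reduced, normalForm, K0, K2, K4, quadraticPart, cubicPart, mul_zero, sub_zero]
  generalize Real.cos (2 * Complex.arg ⟨x, y⟩) = c at key
  set j := (x ^ 2 + y ^ 2) / 2 with hj
  have hc : j * c = (x ^ 2 - y ^ 2) / 2 := by rw [hj]; linear_combination key / 2
  have h3 : (3 * x ^ 2 + y ^ 2) / 2 = 2 * j + j * c := by rw [hc, hj]; ring
  rw [h3, ← hc]
  ring

/-! ### Roots of the quartic coefficients -/

theorem sq_sqrt_abs (a : ℝ) : √|a| ^ 2 = |a| := Real.sq_sqrt (abs_nonneg a)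

theorem abs_rpow_half (a : ℝ) : |a| ^ (1 / 2 : ℝ) = √|a| := (Real.sqrt_eq_rpow _).symm

theorem abs_rpow_three_halves (a : ℝ) : |a| ^ (3 / 2 : ℝ) = √|a| ^ 3 := by
  rw [Real.sqrt_eq_rpow, ← Real.rpow_natCast, ← Real.rpow_mul (abs_nonneg a)]
  norm_num

theorem sq_abs_rpow_quarter (a : ℝ) : (|a| ^ (1 / 4 : ℝ)) ^ 2 = √|a| := by
  rw [Real.sqrt_eq_rpow, ← Real.rpow_natCast, ← Real.rpow_mul (abs_nonneg a)]
  norm_num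

variable {v}

theorem A_sub_three_mul_C_ne_zero (hCA3 : v.C ≠ v.A / 3) : v.A - 3 * v.C ≠ 0 := fun h => hCA3 (by linarith)

theorem A_sub_C_ne_zero (hCA : v.C ≠ v.A) : v.A - v.C ≠ 0 := fun h => hCA (by linarith)

theorem ε₁_mul_sq (h : v.A - 3 * v.C ≠ 0) : v.ε₁ * √|v.A - 3 * v.C| ^ 2 = v.A - 3 * v.C := by
  rw [sq_sqrt_abs, ε₁, div_mul_cancel₀ _ (abs_ne_zero.2 h)]

theorem ε₂_mul_sq (h : v.A - v.C ≠ 0) : v.ε₂ * √|v.A - v.C| ^ 2 = v.A - v.C := by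
  rw [sq_sqrt_abs, ε₂, div_mul_cancel₀ _ (abs_ne_zero.2 h)]

theorem ε₁_sq (h : v.A - 3 * v.C ≠ 0) : v.ε₁ ^ 2 = 1 := by
  rw [ε₁, div_pow, sq_abs, div_self (pow_ne_zero 2 h)]

theorem ε₂_sq (h : v.A - v.C ≠ 0) : v.ε₂ ^ 2 = 1 := by
  rw [ε₂, div_pow, sq_abs, div_self (pow_ne_zero 2 h)]

theorem μ_eq : v.μ = 2 * (v.A - 2 * v.C) / (√|v.A - 3 * v.C| * √|v.A - v.C|) := by
  rw [μ, abs_mul, Real.sqrt_mul (abs_nonneg _)]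

theorem discriminant_ne_zero (h₁ : v.A - 3 * v.C ≠ 0) (h₂ : v.A - v.C ≠ 0) (hC : v.C ≠ 0) :
    4 * v.ε₁ * v.ε₂ - v.μ ^ 2 ≠ 0 := by
  have hP : √|v.A - 3 * v.C| ≠ 0 := by positivity
  have hQ : √|v.A - v.C| ≠ 0 := by positivity
  have key : (√|v.A - 3 * v.C| * √|v.A - v.C|) ^ 2 * (4 * v.ε₁ * v.ε₂ - v.μ ^ 2)
      = -4 * v.C ^ 2 := by
    have hμ : v.μ * (√|v.A - 3 * v.C| * √|v.A - v.C|) = 2 * (v.A - 2 * v.C) := by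
      rw [μ_eq, div_mul_cancel₀ _ (mul_ne_zero hP hQ)]
    linear_combination 4 * v.ε₂ * √|v.A - v.C| ^ 2 * ε₁_mul_sq h₁
      + 4 * (v.A - 3 * v.C) * ε₂_mul_sq h₂
      - (v.μ * (√|v.A - 3 * v.C| * √|v.A - v.C|) + 2 * (v.A - 2 * v.C)) * hμ
  intro h
  rw [h, mul_zero] at key
  exact hC (by simpa using key.symm)

/-! ### The coefficients of the cubic map -/

variable (v) in
/-- The coefficients of `x³` and `x y²` in the first component of the cubic map, followed by those
of `x² y` and `y³` in the second. -/
noncomputable def cubicCoeff : ℝ × ℝ × ℝ × ℝ :=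
  (-(v.t60 * v.ε₁ / 4),
    (v.ε₁ * (2 * v.ε₂ * v.t24 - v.μ * v.t06) * v.μ + 2 * v.μ * v.t60 - 4 * v.ε₁ * v.t42)
        / (4 * v.ε₁ * v.ε₂ * (4 * v.ε₁ * v.ε₂ - v.μ ^ 2)),
    (v.ε₂ * (2 * v.ε₁ * v.t42 - v.μ * v.t60) * v.μ + 2 * v.μ * v.t06 - 4 * v.ε₂ * v.t24)
        / (4 * v.ε₁ * v.ε₂ * (4 * v.ε₁ * v.ε₂ - v.μ ^ 2)),
    -(v.t06 * v.ε₂ / 4))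

theorem cubicMap_eq (p : ℝ × ℝ) :
    v.cubicMap p = reflectionEquivariantMap (fun _ => v.cubicCoeff) p := by
  simp only [cubicMap, reflectionEquivariantMap, cubicCoeff, Prod.mk.injEq]
  constructor <;> ring

/-- The homological equation: the cubic map removes the sextic terms at `E = δ = 0`. -/
theorem cubicCoeff_homological (h₁ : v.A - 3 * v.C ≠ 0) (h₂ : v.A - v.C ≠ 0) (hC : v.C ≠ 0) :
    v.t60 + 4 * v.ε₁ * v.cubicCoeff.1 = 0 ∧
    v.t42 + 4 * v.ε₁ * v.cubicCoeff.2.1 + 2 * v.μ * (v.cubicCoeff.1 + v.cubicCoeff.2.2.1) = 0 ∧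
    v.t24 + 2 * v.μ * (v.cubicCoeff.2.1 + v.cubicCoeff.2.2.2) + 4 * v.ε₂ * v.cubicCoeff.2.2.1 = 0 ∧
    v.t06 + 4 * v.ε₂ * v.cubicCoeff.2.2.2 = 0 := by
  have hD := discriminant_ne_zero h₁ h₂ hC
  simp only [cubicCoeff]
  generalize v.μ = m at *
  have e₁ := ε₁_sq h₁
  have e₂ := ε₂_sq h₂
  generalize v.ε₁ = a at *
  generalize v.ε₂ = b at *
  rcases mul_self_eq_one_iff.1 ((sq _).symm.trans e₁) with rfl | rfl <;>
  rcases mul_self_eq_one_iff.1 ((sq _).symm.trans e₂) with rfl | rfl <;>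
  norm_num at hD ⊢ <;>
  refine ⟨by ring, ?_, ?_, by ring⟩ <;> field_simp <;> ring

/-- The homological equation in the original coordinates. -/
theorem unscaled_homological (h₁ : v.A - 3 * v.C ≠ 0) (h₂ : v.A - v.C ≠ 0) (hC : v.C ≠ 0)
    {α β γ κ : ℝ} (hα : α = v.cubicCoeff.1 * √|v.A - 3 * v.C|)
    (hβ : β = v.cubicCoeff.2.1 * √|v.A - v.C|)
    (hγ : γ = v.cubicCoeff.2.2.1 * √|v.A - 3 * v.C|)
    (hκ : κ = v.cubicCoeff.2.2.2 * √|v.A - v.C|) :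
    v.s60 + 4 * (v.A - 3 * v.C) * α = 0 ∧
    v.s42 + 4 * (v.A - 3 * v.C) * β + 4 * (v.A - 2 * v.C) * (α + γ) = 0 ∧
    v.s24 + 4 * (v.A - 2 * v.C) * (β + κ) + 4 * (v.A - v.C) * γ = 0 ∧
    v.s06 + 4 * (v.A - v.C) * κ = 0 := by
  obtain ⟨g₀, g₁, g₂, g₃⟩ := cubicCoeff_homological h₁ h₂ hC
  have e₁ := ε₁_mul_sq h₁
  have e₂ := ε₂_mul_sq h₂
  have hP : √|v.A - 3 * v.C| ≠ 0 := by positivity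
  have hQ : √|v.A - v.C| ≠ 0 := by positivity
  have hμ : v.μ * (√|v.A - 3 * v.C| * √|v.A - v.C|) = 2 * (v.A - 2 * v.C) := by
    rw [μ_eq, div_mul_cancel₀ _ (mul_ne_zero hP hQ)]
  have t0 : v.t60 * √|v.A - 3 * v.C| ^ 3 = v.s60 := by
    rw [t60, abs_rpow_three_halves, div_mul_cancel₀ _ (pow_ne_zero 3 hP)]
  have t3 : v.t06 * √|v.A - v.C| ^ 3 = v.s06 := by
    rw [t06, abs_rpow_three_halves, div_mul_cancel₀ _ (pow_ne_zero 3 hQ)]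
  have t1 : v.t42 * (√|v.A - 3 * v.C| ^ 2 * √|v.A - v.C|) = v.s42 := by
    rw [t42, abs_rpow_half, sq_sqrt_abs (v.A - 3 * v.C), div_mul_cancel₀]
    positivity
  have t2 : v.t24 * (√|v.A - 3 * v.C| * √|v.A - v.C| ^ 2) = v.s24 := by
    rw [t24, abs_rpow_half, sq_sqrt_abs (v.A - v.C), div_mul_cancel₀]
    positivity
  generalize √|v.A - 3 * v.C| = P at *
  generalize √|v.A - v.C| = Q at *
  subst hα hβ hγ hκ
  refine ⟨?_, ?_, ?_, ?_⟩
  · linear_combination P ^ 3 * g₀ - t0 - 4 * v.cubicCoeff.1 * P * e₁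
  · linear_combination P ^ 2 * Q * g₁ - t1 - 4 * v.cubicCoeff.2.1 * Q * e₁
      - 2 * P * (v.cubicCoeff.1 + v.cubicCoeff.2.2.1) * hμ
  · linear_combination P * Q ^ 2 * g₂ - t2 - 4 * v.cubicCoeff.2.2.1 * P * e₂
      - 2 * Q * (v.cubicCoeff.2.1 + v.cubicCoeff.2.2.2) * hμ
  · linear_combination Q ^ 3 * g₃ - t3 - 4 * v.cubicCoeff.2.2.2 * Q * e₂

theorem v40_eq : v.v40 = 4 / 3 * v.A + 2 / 3 * v.B := by rw [A, B]; ring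

theorem v04_eq : v.v04 = 4 / 3 * v.A - 2 / 3 * v.B := by rw [A, B]; ring

theorem v22_eq : v.v22 = 8 * v.C := by rw [C]; ring

variable (v) in
/-- The derivative of `quadraticPart` with respect to `U`. -/
noncomputable def quadraticPartU (E δ U V : ℝ) : ℝ :=
  δ / 2 + 3 / 2 * v.v40 * ((U + V) / 2) - 3 / 2 * v.v04 * (E - (U + V) / 2)
    + 1 / 4 * v.v22 * (3 * (E - (U + V) / 2) - (3 * U + V) / 2)

variable (v) in
/-- The derivative of `quadraticPart` with respect to `V`. -/
noncomputable def quadraticPartV (E δ U V : ℝ) : ℝ :=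
  δ / 2 + 3 / 2 * v.v40 * ((U + V) / 2) - 3 / 2 * v.v04 * (E - (U + V) / 2)
    + 1 / 4 * v.v22 * ((E - (U + V) / 2) - (3 * U + V) / 2)

theorem quadraticPart_add (E δ U V ξ η : ℝ) :
    v.quadraticPart E δ (U + ξ) (V + η) = v.quadraticPart E δ U V
      + v.quadraticPartU E δ U V * ξ + v.quadraticPartV E δ U V * η
      + (3 / 8 * (v.v40 + v.v04) * ((ξ + η) * (ξ + η))
        - 1 / 8 * v.v22 * ((ξ + η) * (3 * ξ + η))) := by
  rw [quadraticPart, quadraticPart, quadraticPartU, quadraticPartV]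
  ring

theorem coefficient_mul_sq {a P : ℝ} (ha : a ≠ 0) (hP : P ≠ 0) (n N : ℝ) :
    -(a / P ^ 2) / (n * a ^ 2) * N * P ^ 2 = -N / (n * a) := by
  rcases eq_or_ne n 0 with rfl | hn
  · simp
  · field_simp

theorem coefficient_mul {a c P Q ε ε' : ℝ} (ha : a ≠ 0) (hc : c ≠ 0) (hP : P ≠ 0) (hQ : Q ≠ 0)
    (hε : ε = P ^ 2 / a) (hε' : ε' = Q ^ 2 / c) (n N : ℝ) :
    ε * ε' / (n * Q ^ 3 * P ^ 3) * N * (P * Q) = N / (n * (a * c)) := by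
  rcases eq_or_ne n 0 with rfl | hn
  · simp
  · rw [hε, hε']; field_simp

theorem ε₁_eq (h : v.A - 3 * v.C ≠ 0) : v.ε₁ = √|v.A - 3 * v.C| ^ 2 / (v.A - 3 * v.C) := by
  rw [eq_div_iff h]
  linear_combination (-v.ε₁) * ε₁_mul_sq h + √|v.A - 3 * v.C| ^ 2 * ε₁_sq h

theorem ε₂_eq (h : v.A - v.C ≠ 0) : v.ε₂ = √|v.A - v.C| ^ 2 / (v.A - v.C) := by
  rw [eq_div_iff h]
  linear_combination (-v.ε₂) * ε₂_mul_sq h + √|v.A - v.C| ^ 2 * ε₂_sq h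

theorem a5_mul_sq (h₁ : v.A - 3 * v.C ≠ 0) {α : ℝ} (g₀ : v.s60 + 4 * (v.A - 3 * v.C) * α = 0) :
    v.a5 * √|v.A - 3 * v.C| ^ 2 = 2 * (v.B - 2 * v.A + 6 * v.C) * α
      + 3 / 16 * (10 * v.v06 - 17 * v.v04 ^ 2)
      + 1 / 16 * (10 * v.v42 - 17 / 4 * v.v22 ^ 2 - 17 * v.v22 * v.v40)
      - 1 / 8 * (10 * v.v24 - 17 / 4 * v.v22 ^ 2 - 17 * v.v22 * v.v04) := by
  have hP : √|v.A - 3 * v.C| ≠ 0 := by positivity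
  have e₁ : v.ε₁ = (v.A - 3 * v.C) / √|v.A - 3 * v.C| ^ 2 := by rw [ε₁, sq_sqrt_abs]
  rw [s60] at g₀
  rw [a5, e₁, coefficient_mul_sq h₁ hP, v40_eq, v04_eq, v22_eq, div_eq_iff (by simpa using h₁)]
  linear_combination (-144) * (v.B - 2 * v.A + 6 * v.C) * g₀

theorem a7_mul_sq (h₂ : v.A - v.C ≠ 0) {κ : ℝ} (g₃ : v.s06 + 4 * (v.A - v.C) * κ = 0) :
    v.a7 * √|v.A - v.C| ^ 2 = 2 * (v.B - 2 * v.A + 2 * v.C) * κ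
      + 3 / 16 * (10 * v.v06 - 17 * v.v04 ^ 2)
      + 1 / 16 * (2 * v.v42 - 1 / 4 * v.v22 ^ 2 - 7 * v.v22 * v.v40)
      - 1 / 8 * (2 * v.v24 - 1 / 4 * v.v22 ^ 2 - 7 * v.v22 * v.v04) := by
  have hQ : √|v.A - v.C| ≠ 0 := by positivity
  have e₂ : v.ε₂ = (v.A - v.C) / √|v.A - v.C| ^ 2 := by rw [ε₂, sq_sqrt_abs]
  rw [s06] at g₃
  rw [a7, e₂, coefficient_mul_sq h₂ hQ, v40_eq, v04_eq, v22_eq, div_eq_iff (by simpa using h₂)]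
  linear_combination (-144) * (v.B - 2 * v.A + 2 * v.C) * g₃

theorem b5_mul_sq (h₁ : v.A - 3 * v.C ≠ 0) {α : ℝ} (g₀ : v.s60 + 4 * (v.A - 3 * v.C) * α = 0)
    (δ : ℝ) :
    v.b5 δ * √|v.A - 3 * v.C| ^ 2 = δ * (α - 3 / 4 * v.v40 + 3 / 8 * v.v22) := by
  have hP : √|v.A - 3 * v.C| ≠ 0 := by positivity
  have e₁ : v.ε₁ = (v.A - 3 * v.C) / √|v.A - 3 * v.C| ^ 2 := by rw [ε₁, sq_sqrt_abs]
  rw [s60] at g₀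
  rw [b5, e₁, mul_assoc _ _ δ, mul_div_right_comm, coefficient_mul_sq h₁ hP, v40_eq, v22_eq,
    div_eq_iff (by simpa using h₁)]
  linear_combination (-144) * δ * g₀

theorem b7_mul_sq (h₂ : v.A - v.C ≠ 0) {κ : ℝ} (g₃ : v.s06 + 4 * (v.A - v.C) * κ = 0) (δ : ℝ) :
    v.b7 δ * √|v.A - v.C| ^ 2 = δ * (κ - 3 / 4 * v.v40 + 1 / 8 * v.v22) := by
  have hQ : √|v.A - v.C| ≠ 0 := by positivity
  have e₂ : v.ε₂ = (v.A - v.C) / √|v.A - v.C| ^ 2 := by rw [ε₂, sq_sqrt_abs]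
  rw [s06] at g₃
  rw [b7, e₂, mul_assoc _ _ δ, mul_div_right_comm, coefficient_mul_sq h₂ hQ, v40_eq, v22_eq,
    div_eq_iff (by simpa using h₂)]
  linear_combination (-144) * δ * g₃

theorem a6_mul (h₁ : v.A - 3 * v.C ≠ 0) (h₂ : v.A - v.C ≠ 0) (hC : v.C ≠ 0) {α β γ κ : ℝ}
    (g₀ : v.s60 + 4 * (v.A - 3 * v.C) * α = 0)
    (g₁ : v.s42 + 4 * (v.A - 3 * v.C) * β + 4 * (v.A - 2 * v.C) * (α + γ) = 0)
    (g₂ : v.s24 + 4 * (v.A - 2 * v.C) * (β + κ) + 4 * (v.A - v.C) * γ = 0)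
    (g₃ : v.s06 + 4 * (v.A - v.C) * κ = 0) :
    v.a6 * (√|v.A - 3 * v.C| * √|v.A - v.C|) =
      2 * (v.B - 2 * v.A + 6 * v.C) * β + 2 * (v.B - 2 * v.A + 2 * v.C) * γ
      + 3 / 8 * (10 * v.v06 - 17 * v.v04 ^ 2)
      + 1 / 8 * (6 * v.v42 - 9 / 4 * v.v22 ^ 2 - 12 * v.v22 * v.v40)
      - 1 / 4 * (6 * v.v24 - 9 / 4 * v.v22 ^ 2 - 12 * v.v22 * v.v04) := by
  have hP : √|v.A - 3 * v.C| ≠ 0 := by positivity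
  have hQ : √|v.A - v.C| ≠ 0 := by positivity
  rw [s60] at g₀
  rw [s42] at g₁
  rw [s24] at g₂
  rw [s06] at g₃
  rw [a6, abs_rpow_three_halves, abs_rpow_three_halves, abs_sub_comm v.C, abs_sub_comm (3 * v.C),
    coefficient_mul h₁ h₂ hP hQ (ε₁_eq h₁) (ε₂_eq h₂), v40_eq, v04_eq, v22_eq,
    div_eq_iff (by simpa using ⟨h₁, h₂⟩)]
  refine mul_left_cancel₀ (pow_ne_zero 2 hC) ?_
  linear_combination (-72) * (v.A - 3 * v.C) * (v.A - v.C) *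
      (((v.B - 2 * v.A + 2 * v.C) * (v.A - 2 * v.C) - (v.B - 2 * v.A + 6 * v.C) * (v.A - v.C)) * g₁
      + ((v.B - 2 * v.A + 6 * v.C) * (v.A - 2 * v.C)
        - (v.B - 2 * v.A + 2 * v.C) * (v.A - 3 * v.C)) * g₂)
    + 72 * (v.A - 2 * v.C) * (v.A - v.C) * ((v.B - 2 * v.A + 2 * v.C) * (v.A - 2 * v.C)
      - (v.B - 2 * v.A + 6 * v.C) * (v.A - v.C)) * g₀
    + 72 * (v.A - 2 * v.C) * (v.A - 3 * v.C) * ((v.B - 2 * v.A + 6 * v.C) * (v.A - 2 * v.C)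
      - (v.B - 2 * v.A + 2 * v.C) * (v.A - 3 * v.C)) * g₃

theorem b6_mul (h₁ : v.A - 3 * v.C ≠ 0) (h₂ : v.A - v.C ≠ 0) (hC : v.C ≠ 0) {α β γ κ : ℝ}
    (g₀ : v.s60 + 4 * (v.A - 3 * v.C) * α = 0)
    (g₁ : v.s42 + 4 * (v.A - 3 * v.C) * β + 4 * (v.A - 2 * v.C) * (α + γ) = 0)
    (g₂ : v.s24 + 4 * (v.A - 2 * v.C) * (β + κ) + 4 * (v.A - v.C) * γ = 0)
    (g₃ : v.s06 + 4 * (v.A - v.C) * κ = 0) (δ : ℝ) :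
    v.b6 δ * (√|v.A - 3 * v.C| * √|v.A - v.C|) =
      δ * (β + γ - 3 / 2 * v.v40 + 1 / 2 * v.v22) := by
  have hP : √|v.A - 3 * v.C| ≠ 0 := by positivity
  have hQ : √|v.A - v.C| ≠ 0 := by positivity
  rw [s60] at g₀
  rw [s42] at g₁
  rw [s24] at g₂
  rw [s06] at g₃
  rw [b6, abs_rpow_three_halves, abs_rpow_three_halves, abs_sub_comm v.C, abs_sub_comm (3 * v.C),
    mul_div_assoc', mul_assoc _ _ δ, mul_div_right_comm,
    coefficient_mul h₁ h₂ hP hQ (ε₁_eq h₁) (ε₂_eq h₂), v40_eq, v22_eq,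
    div_eq_iff (by simpa using ⟨h₁, h₂⟩)]
  refine mul_left_cancel₀ (pow_ne_zero 2 hC) ?_
  linear_combination (-72) * δ * (v.A - 3 * v.C) * (v.A - v.C) *
      (((v.A - 2 * v.C) - (v.A - v.C)) * g₁ + ((v.A - 2 * v.C) - (v.A - 3 * v.C)) * g₂)
    + 72 * δ * (v.A - 2 * v.C) * (v.A - v.C) * ((v.A - 2 * v.C) - (v.A - v.C)) * g₀
    + 72 * δ * (v.A - 2 * v.C) * (v.A - 3 * v.C) * ((v.A - 2 * v.C) - (v.A - 3 * v.C)) * g₃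

/-- Up to terms of degree four, the planar Hamiltonian in the new coordinates is the quartic
form. -/
theorem truncation_eq_Kb (h₁ : v.A - 3 * v.C ≠ 0) (h₂ : v.A - v.C ≠ 0) (hC : v.C ≠ 0)
    {α β γ κ : ℝ} (hα : α = v.cubicCoeff.1 * √|v.A - 3 * v.C|)
    (hβ : β = v.cubicCoeff.2.1 * √|v.A - v.C|)
    (hγ : γ = v.cubicCoeff.2.2.1 * √|v.A - 3 * v.C|)
    (hκ : κ = v.cubicCoeff.2.2.2 * √|v.A - v.C|) (E δ : ℝ) {p : ℝ × ℝ} {U V : ℝ}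
    (hU : p.1 ^ 2 = √|v.A - 3 * v.C| * U) (hV : p.2 ^ 2 = √|v.A - v.C| * V) :
    v.quadraticPart E δ U V + v.quadraticPartU E δ U V * (2 * U * (α * U + β * V))
      + v.quadraticPartV E δ U V * (2 * V * (γ * U + κ * V)) + v.cubicPart E δ U V
      - v.quadraticPart E δ 0 0 - v.cubicPart E δ 0 0 = v.Kb E δ p := by
  obtain ⟨g₀, g₁, g₂, g₃⟩ := unscaled_homological h₁ h₂ hC hα hβ hγ hκ
  clear hα hβ hγ hκ
  have hP : √|v.A - 3 * v.C| ≠ 0 := by positivity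
  have hQ : √|v.A - v.C| ≠ 0 := by positivity
  have hμ : v.μ * (√|v.A - 3 * v.C| * √|v.A - v.C|) = 2 * (v.A - 2 * v.C) := by
    rw [μ_eq, div_mul_cancel₀ _ (mul_ne_zero hP hQ)]
  have e₁ := ε₁_mul_sq h₁
  have e₂ := ε₂_mul_sq h₂
  have k5 := a5_mul_sq h₁ g₀
  have k6 := a6_mul h₁ h₂ hC g₀ g₁ g₂ g₃
  have k7 := a7_mul_sq h₂ g₃
  have l5 := b5_mul_sq h₁ g₀ δ
  have l6 := b6_mul h₁ h₂ hC g₀ g₁ g₂ g₃ δ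
  have l7 := b7_mul_sq h₂ g₃ δ
  have k1 : v.a1 * √|v.A - 3 * v.C| = v.B - 2 * v.A + 6 * v.C := by
    rw [a1, abs_sub_comm, div_mul_cancel₀ _ hP]
  have k3 : v.a3 * √|v.A - v.C| = v.B - 2 * v.A + 2 * v.C := by
    rw [a3, abs_sub_comm, div_mul_cancel₀ _ hQ]
  have k2 : v.a2 * √|v.A - 3 * v.C| = -3 / 8 * (10 * v.v06 - 17 * v.v04 ^ 2)
      + 1 / 8 * (10 * v.v24 - 17 / 4 * v.v22 ^ 2 - 17 * v.v22 * v.v04) := by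
    rw [a2, abs_sub_comm, v04_eq, v22_eq]
    generalize √|v.A - 3 * v.C| = P at *
    field_simp
    ring
  have k4 : v.a4 * √|v.A - v.C| = -3 / 8 * (10 * v.v06 - 17 * v.v04 ^ 2)
      + 1 / 8 * (2 * v.v24 - 1 / 4 * v.v22 ^ 2 - 7 * v.v22 * v.v04) := by
    rw [a4, abs_sub_comm, v04_eq, v22_eq]
    generalize √|v.A - v.C| = Q at *
    field_simp
    ring
  have l1 : v.b1 δ * √|v.A - 3 * v.C| = -(6 * v.C * δ) := by
    rw [b1, abs_sub_comm, div_mul_cancel₀ _ hP]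
  have l3 : v.b3 δ * √|v.A - v.C| = -(2 * v.C * δ) := by
    rw [b3, abs_sub_comm, div_mul_cancel₀ _ hQ]
  have l2 : v.b2 δ * √|v.A - 3 * v.C| = δ / 2 := by
    rw [b2, abs_sub_comm, ← div_div, div_mul_cancel₀ _ hP]
  have l4 : v.b4 δ * √|v.A - v.C| = δ / 2 := by
    rw [b4, abs_sub_comm, ← div_div, div_mul_cancel₀ _ hQ]
  rw [s60] at g₀
  rw [s42] at g₁
  rw [s24] at g₂
  rw [s06] at g₃
  rw [Kb, show p.1 ^ 4 = (p.1 ^ 2) ^ 2 by ring, show p.2 ^ 4 = (p.2 ^ 2) ^ 2 by ring, hU, hV]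
  simp only [quadraticPart, quadraticPartU, quadraticPartV, cubicPart, v40_eq, v04_eq, v22_eq]
    at *
  linear_combination (-U) * (E * k1 + E ^ 2 * k2 + E * l1 + l2)
    - V * (E * k3 + E ^ 2 * k4 + E * l3 + l4) - U ^ 2 * (e₁ + E * k5 + l5)
    - U * V * (hμ + E * k6 + l6) - V ^ 2 * (e₂ + E * k7 + l7)
    + U ^ 3 * g₀ + U ^ 2 * V * g₁ + U * V ^ 2 * g₂ + V ^ 3 * g₃

end Resonance22.Potential

section Asymptotics

variable {α : Type*} {l : Filter α} {N : α → ℝ}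

theorem Asymptotics.IsBigO.pow_of_le (hN : N =O[l] fun _ => (1 : ℝ)) {f : α → ℝ} {j k : ℕ}
    (h : j ≤ k) (hf : f =O[l] fun q => N q ^ k) : f =O[l] fun q => N q ^ j := by
  refine hf.trans ?_
  obtain ⟨i, rfl⟩ := Nat.exists_eq_add_of_le h
  have := (isBigO_refl (fun q => N q ^ j) l).mul (hN.pow i)
  simpa [pow_add] using this

theorem MvPolynomial.eval_isBigO_pow {n : ℕ} (r : MvPolynomial (Fin n) ℝ) {k : ℕ}
    (hr : ∀ m ∈ r.support, k ≤ m.degree) (hN : N =O[l] fun _ => (1 : ℝ)) {f : α → Fin n → ℝ}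
    (hf : ∀ i, (fun q => f q i) =O[l] N) :
    (fun q => MvPolynomial.eval (f q) r) =O[l] fun q => N q ^ k := by
  simp only [MvPolynomial.eval_eq']
  refine IsBigO.fun_sum fun m hm => IsBigO.const_mul_left ?_ _
  refine IsBigO.pow_of_le hN (hr m hm) ?_
  have := IsBigO.finsetProd (s := Finset.univ) fun i _ => (hf i).pow (m i)
  refine this.congr_right fun q => ?_
  rw [Finset.prod_pow_eq_pow_sum, Finsupp.degree_eq_sum]

theorem Asymptotics.IsBigO.mul_mul_sub_mul_mul {a b c a' b' c' : α → ℝ}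
    (ha : a =O[l] N) (hb : b =O[l] N) (hc : c =O[l] N)
    (ha' : (fun q => a' q - a q) =O[l] fun q => N q ^ 2)
    (hb' : (fun q => b' q - b q) =O[l] fun q => N q ^ 2)
    (hc' : (fun q => c' q - c q) =O[l] fun q => N q ^ 2) (hN : N =O[l] fun _ => (1 : ℝ)) :
    (fun q => a' q * b' q * c' q - a q * b q * c q) =O[l] fun q => N q ^ 4 := by
  have up : ∀ {u u' : α → ℝ}, u =O[l] N → (fun q => u' q - u q) =O[l] (fun q => N q ^ 2) →
      u' =O[l] N := by
    intro u u' hu hu'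
    have := hu.add ((IsBigO.pow_of_le hN one_le_two hu').congr_right fun q => pow_one _)
    exact this.congr_left fun q => by ring
  have hb'' := up hb hb'
  have hc'' := up hc hc'
  have t1 := ((ha'.mul hb'').mul hc'').congr_right (g₂ := fun q => N q ^ 4) fun q => by ring
  have t2 := ((ha.mul hb').mul hc'').congr_right (g₂ := fun q => N q ^ 4) fun q => by ring
  have t3 := ((ha.mul hb).mul hc').congr_right (g₂ := fun q => N q ^ 4) fun q => by ring
  exact ((t1.add t2).add t3).congr_left fun q => by ring

end Asymptotics

namespace Resonance22.Potential

variable {v : Potential}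

theorem cubicPart_add_sub_isBigO {α : Type*} {l : Filter α} {N E δ U V ξ η : α → ℝ}
    (hN : N =O[l] fun _ => (1 : ℝ)) (hE : E =O[l] N) (hδ : δ =O[l] N) (hU : U =O[l] N)
    (hV : V =O[l] N) (hξ : ξ =O[l] fun q => N q ^ 2) (hη : η =O[l] fun q => N q ^ 2) :
    (fun q => v.cubicPart (E q) (δ q) (U q + ξ q) (V q + η q)
      - v.cubicPart (E q) (δ q) (U q) (V q)) =O[l] fun q => N q ^ 4 := by
  have hδ' : (fun q => δ q - δ q) =O[l] fun q => N q ^ 2 := by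
    simpa using isBigO_zero (fun q => N q ^ 2) l
  have lin : ∀ a b c : ℝ, (fun q => a * E q + b * U q + c * V q) =O[l] N ∧
      (fun q => (a * E q + b * (U q + ξ q) + c * (V q + η q)) - (a * E q + b * U q + c * V q))
        =O[l] fun q => N q ^ 2 := fun a b c =>
    ⟨((hE.const_mul_left a).add (hU.const_mul_left b)).add (hV.const_mul_left c),
      ((hξ.const_mul_left b).add (hη.const_mul_left c)).congr_left fun q => by ring⟩
  obtain ⟨J, J'⟩ := lin 0 (1 / 2) (1 / 2)
  obtain ⟨G, G'⟩ := lin 1 (-1 / 2) (-1 / 2)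
  obtain ⟨H, H'⟩ := lin 0 (3 / 2) (1 / 2)
  obtain ⟨M, M'⟩ := lin 0
    ((10 * v.v42 - 17 / 4 * v.v22 ^ 2 - 17 * v.v22 * v.v40) / 2)
    ((2 * v.v42 - 1 / 4 * v.v22 ^ 2 - 7 * v.v22 * v.v40) / 2)
  obtain ⟨L, L'⟩ := lin 0
    ((10 * v.v24 - 17 / 4 * v.v22 ^ 2 - 17 * v.v22 * v.v04) / 2)
    ((2 * v.v24 - 1 / 4 * v.v22 ^ 2 - 7 * v.v22 * v.v04) / 2)
  have t1 := (IsBigO.mul_mul_sub_mul_mul hδ J J hδ' J' J' hN).const_mul_left (-3 * v.v40)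
  have t2 := (IsBigO.mul_mul_sub_mul_mul hδ G H hδ' G' H' hN).const_mul_left (-1 / 2 * v.v22)
  have t3 := (IsBigO.mul_mul_sub_mul_mul J J J J' J' J' hN).const_mul_left
    (1 / 4 * (10 * v.v60 - 17 * v.v40 ^ 2))
  have t4 := (IsBigO.mul_mul_sub_mul_mul G G G G' G' G' hN).const_mul_left
    (1 / 4 * (10 * v.v06 - 17 * v.v04 ^ 2))
  have t5 := (IsBigO.mul_mul_sub_mul_mul J G M J' G' M' hN).const_mul_left (1 / 4)
  have t6 := (IsBigO.mul_mul_sub_mul_mul G G L G' G' L' hN).const_mul_left (1 / 4)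
  refine (((((t1.add t2).add t3).add t4).add t5).add t6).congr_left fun q => ?_
  rw [cubicPart, cubicPart]
  ring

/-- The square of a perturbation of `x (1 + a x² + b y²)`, up to terms of order six. -/
theorem sq_sub_isBigO {u w : ℝ × ℝ → ℝ} {a b : ℝ}
    (hw : (fun p => w p) =O[𝓝 (0 : ℝ × ℝ)] fun p => ‖p‖)
    (hu : (fun p => u p - w p * (1 + (p.1 ^ 2 * a + p.2 ^ 2 * b))) =O[𝓝 0] fun p => ‖p‖ ^ 5) :
    (fun p => u p ^ 2 - (w p ^ 2 + 2 * w p ^ 2 * (p.1 ^ 2 * a + p.2 ^ 2 * b)))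
      =O[𝓝 0] fun p => ‖p‖ ^ 6 := by
  have hN : (fun p : ℝ × ℝ => ‖p‖) =O[𝓝 0] fun _ => (1 : ℝ) :=
    (continuous_norm.tendsto (0 : ℝ × ℝ)).isBigO_one ℝ
  have hfst : (fun p : ℝ × ℝ => p.1) =O[𝓝 0] fun p => ‖p‖ := .of_norm_le fun p => norm_fst_le p
  have hsnd : (fun p : ℝ × ℝ => p.2) =O[𝓝 0] fun p => ‖p‖ := .of_norm_le fun p => norm_snd_le p
  have hl : (fun p : ℝ × ℝ => p.1 ^ 2 * a + p.2 ^ 2 * b) =O[𝓝 0] fun p => ‖p‖ ^ 2 :=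
    (((hfst.pow 2).const_mul_left a).add ((hsnd.pow 2).const_mul_left b)).congr_left
      fun p => by ring
  have hwl := ((hw.mul hl).congr_right (g₂ := fun p => ‖p‖ ^ 3) fun p => by ring)
  have hwl1 := (IsBigO.pow_of_le hN (by norm_num : 1 ≤ 3) hwl).congr_right fun p => pow_one _
  have hm := ((hw.add hwl1).const_mul_left 2).mul hu
  have hu1 := (IsBigO.pow_of_le hN (by norm_num : 1 ≤ 5) hu).congr_right fun p => pow_one _
  have hs := hu1.mul hu
  exact ((((hwl.pow 2).congr_right fun p => by ring).add
    (hm.congr_right fun p => by ring)).add (hs.congr_right (g₂ := fun p => ‖p‖ ^ 6)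
      fun p => by ring)).congr_left fun p => by ring

/-- Any map that agrees with the cubic map up to terms of order five brings the planar Hamiltonian
to the quartic form. -/
theorem hasFormKb_of_sub_cubicMap_isBigO (h₁ : v.A - 3 * v.C ≠ 0) (h₂ : v.A - v.C ≠ 0)
    (hC : v.C ≠ 0) {r : MvPolynomial (Fin 4) ℝ} (hr : ∀ m ∈ r.support, 4 ≤ m.degree)
    {φ : ℝ × ℝ → ℝ × ℝ}
    (hφ : (fun p : ℝ × ℝ => φ p - v.cubicMap p) =O[𝓝 0] fun p => ‖p‖ ^ 5) :
    v.HasFormKb r (fun p => v.scaling (φ p)) := by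
  have hP : √|v.A - 3 * v.C| ≠ 0 := by positivity
  have hQ : √|v.A - v.C| ≠ 0 := by positivity
  have hfst : (fun p : ℝ × ℝ => p.1) =O[𝓝 0] fun p => ‖p‖ := .of_norm_le fun p => norm_fst_le p
  have hsnd : (fun p : ℝ × ℝ => p.2) =O[𝓝 0] fun p => ‖p‖ := .of_norm_le fun p => norm_snd_le p
  have s₁ := sq_sub_isBigO (u := fun p => (φ p).1) (a := v.cubicCoeff.1) (b := v.cubicCoeff.2.1)
    hfst (by simpa [cubicMap_eq, reflectionEquivariantMap] using
      (isBigO_fst_prod' (f' := fun p => φ p - v.cubicMap p)).trans hφ)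
  have s₂ := sq_sub_isBigO (u := fun p => (φ p).2) (a := v.cubicCoeff.2.2.1)
    (b := v.cubicCoeff.2.2.2)
    hsnd (by simpa [cubicMap_eq, reflectionEquivariantMap] using
      (isBigO_snd_prod' (f' := fun p => φ p - v.cubicMap p)).trans hφ)
  set N : (ℝ × ℝ) × ℝ × ℝ → ℝ := fun q => q.1.1 ^ 2 + q.1.2 ^ 2 + |q.2.1| + |q.2.2| with hNdef
  have hN : N =O[𝓝 0] fun _ => (1 : ℝ) := by
    have : Continuous N := by fun_prop
    exact (this.tendsto 0).isBigO_one ℝ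
  have hN0 : ∀ q, ‖N q‖ = N q := fun q => Real.norm_of_nonneg (by positivity)
  have hx : (fun q : (ℝ × ℝ) × ℝ × ℝ => q.1.1 ^ 2) =O[𝓝 0] N :=
    .of_norm_le fun q => by
      rw [Real.norm_of_nonneg (by positivity)]; simp only [hNdef]
      linarith [sq_nonneg q.1.2, abs_nonneg q.2.1, abs_nonneg q.2.2]
  have hy : (fun q : (ℝ × ℝ) × ℝ × ℝ => q.1.2 ^ 2) =O[𝓝 0] N :=
    .of_norm_le fun q => by
      rw [Real.norm_of_nonneg (by positivity)]; simp only [hNdef]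
      linarith [sq_nonneg q.1.1, abs_nonneg q.2.1, abs_nonneg q.2.2]
  have hE : (fun q : (ℝ × ℝ) × ℝ × ℝ => q.2.1) =O[𝓝 0] N :=
    .of_norm_le fun q => by
      rw [Real.norm_eq_abs]; simp only [hNdef]
      linarith [sq_nonneg q.1.1, sq_nonneg q.1.2, abs_nonneg q.2.2]
  have hδ : (fun q : (ℝ × ℝ) × ℝ × ℝ => q.2.2) =O[𝓝 0] N :=
    .of_norm_le fun q => by
      rw [Real.norm_eq_abs]; simp only [hNdef]
      linarith [sq_nonneg q.1.1, sq_nonneg q.1.2, abs_nonneg q.2.1]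
  have hp : (fun q : (ℝ × ℝ) × ℝ × ℝ => ‖q.1‖ ^ 2) =O[𝓝 0] N := by
    have : (fun q : (ℝ × ℝ) × ℝ × ℝ => ‖q.1‖ ^ 2) =O[𝓝 0]
        fun q => ‖q.1.1 ^ 2‖ + ‖q.1.2 ^ 2‖ := .of_norm_le fun q => by
      rw [Real.norm_of_nonneg (by positivity), Prod.norm_def, norm_pow, norm_pow]
      rcases max_choice ‖q.1.1‖ ‖q.1.2‖ with h | h <;> rw [h] <;>
        linarith [sq_nonneg ‖q.1.1‖, sq_nonneg ‖q.1.2‖]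
    exact this.trans (hx.norm_left.add hy.norm_left)
  have hfstt : Tendsto (fun q : (ℝ × ℝ) × ℝ × ℝ => q.1) (𝓝 0) (𝓝 0) :=
    continuous_fst.tendsto' _ _ rfl
  have pull : ∀ {u : ℝ × ℝ → ℝ}, u =O[𝓝 0] (fun p => ‖p‖ ^ 6) →
      (fun q : (ℝ × ℝ) × ℝ × ℝ => u q.1) =O[𝓝 0] fun q => N q ^ 3 := fun hu =>
    (hu.comp_tendsto hfstt).trans ((hp.pow 3).congr_left fun q => by
      simp only [Function.comp_apply]; ring)
  obtain ⟨α, hα⟩ : ∃ α, α = v.cubicCoeff.1 * √|v.A - 3 * v.C| := ⟨_, rfl⟩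
  obtain ⟨β, hβ⟩ : ∃ β, β = v.cubicCoeff.2.1 * √|v.A - v.C| := ⟨_, rfl⟩
  obtain ⟨γ, hγ⟩ : ∃ γ, γ = v.cubicCoeff.2.2.1 * √|v.A - 3 * v.C| := ⟨_, rfl⟩
  obtain ⟨κ, hκ⟩ : ∃ κ, κ = v.cubicCoeff.2.2.2 * √|v.A - v.C| := ⟨_, rfl⟩
  obtain ⟨U, hU⟩ : ∃ U : (ℝ × ℝ) × ℝ × ℝ → ℝ, ∀ q, U q = q.1.1 ^ 2 / √|v.A - 3 * v.C| :=
    ⟨_, fun _ => rfl⟩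
  obtain ⟨V, hV⟩ : ∃ V : (ℝ × ℝ) × ℝ × ℝ → ℝ, ∀ q, V q = q.1.2 ^ 2 / √|v.A - v.C| :=
    ⟨_, fun _ => rfl⟩
  have hU' : ∀ q : (ℝ × ℝ) × ℝ × ℝ, q.1.1 ^ 2 = √|v.A - 3 * v.C| * U q := fun q => by
    rw [hU, mul_div_cancel₀ _ hP]
  have hV' : ∀ q : (ℝ × ℝ) × ℝ × ℝ, q.1.2 ^ 2 = √|v.A - v.C| * V q := fun q => by
    rw [hV, mul_div_cancel₀ _ hQ]
  obtain ⟨ξ, hξ⟩ : ∃ ξ : (ℝ × ℝ) × ℝ × ℝ → ℝ, ∀ q, ξ q = (v.scaling (φ q.1)).1 ^ 2 - U q :=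
    ⟨_, fun _ => rfl⟩
  obtain ⟨η, hη⟩ : ∃ η : (ℝ × ℝ) × ℝ × ℝ → ℝ, ∀ q, η q = (v.scaling (φ q.1)).2 ^ 2 - V q :=
    ⟨_, fun _ => rfl⟩
  have oU : U =O[𝓝 0] N := (hx.const_mul_left (√|v.A - 3 * v.C|)⁻¹).congr_left fun q => by
    rw [hU]; ring
  have oV : V =O[𝓝 0] N := (hy.const_mul_left (√|v.A - v.C|)⁻¹).congr_left fun q => by
    rw [hV]; ring
  have oσ : (fun q => ξ q - 2 * U q * (α * U q + β * V q)) =O[𝓝 0] fun q => N q ^ 3 := by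
    refine ((pull s₁).const_mul_left (√|v.A - 3 * v.C|)⁻¹).congr_left fun q => ?_
    rw [hξ, scaling, div_pow, sq_abs_rpow_quarter, hU', hV', hα, hβ]
    field_simp
    ring
  have oτ : (fun q => η q - 2 * V q * (γ * U q + κ * V q)) =O[𝓝 0] fun q => N q ^ 3 := by
    refine ((pull s₂).const_mul_left (√|v.A - v.C|)⁻¹).congr_left fun q => ?_
    rw [hη, scaling, div_pow, sq_abs_rpow_quarter, hU', hV', hγ, hκ]
    field_simp
    ring
  have oξ : ξ =O[𝓝 0] fun q => N q ^ 2 := by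
    have h1 := ((oU.const_mul_left 2).mul ((oU.const_mul_left α).add (oV.const_mul_left β)))
    exact ((IsBigO.pow_of_le hN (by norm_num : 2 ≤ 3) oσ).add
      (h1.congr_right fun q => (sq _).symm)).congr_left fun q => by ring
  have oη : η =O[𝓝 0] fun q => N q ^ 2 := by
    have h1 := ((oV.const_mul_left 2).mul ((oU.const_mul_left γ).add (oV.const_mul_left κ)))
    exact ((IsBigO.pow_of_le hN (by norm_num : 2 ≤ 3) oτ).add
      (h1.congr_right fun q => (sq _).symm)).congr_left fun q => by ring
  have low : ∀ {u : (ℝ × ℝ) × ℝ × ℝ → ℝ}, u =O[𝓝 0] (fun q => N q ^ 2) → u =O[𝓝 0] N := fun hu =>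
    (IsBigO.pow_of_le hN one_le_two hu).congr_right fun q => pow_one _
  have oX : (fun q : (ℝ × ℝ) × ℝ × ℝ => (v.scaling (φ q.1)).1 ^ 2) =O[𝓝 0] N :=
    (oU.add (low oξ)).congr_left fun q => by rw [hξ]; ring
  have oY : (fun q : (ℝ × ℝ) × ℝ × ℝ => (v.scaling (φ q.1)).2 ^ 2) =O[𝓝 0] N :=
    (oV.add (low oη)).congr_left fun q => by rw [hη]; ring
  have r₁ := MvPolynomial.eval_isBigO_pow (l := 𝓝 0) r hr hN
    (f := fun q => ![(v.scaling (φ q.1)).1 ^ 2, (v.scaling (φ q.1)).2 ^ 2, q.2.1, q.2.2])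
    (fun i => by fin_cases i <;> assumption)
  have r₂ := MvPolynomial.eval_isBigO_pow (l := 𝓝 0) r hr hN
    (f := fun q => ![0, 0, q.2.1, q.2.2])
    (fun i => by fin_cases i <;> first | assumption | exact isBigO_zero _ _)
  have c := cubicPart_add_sub_isBigO (v := v) hN hE hδ oU oV oξ oη
  have lin : ∀ a b c d : ℝ, (fun q => a * q.2.2 + b * q.2.1 + c * U q + d * V q) =O[𝓝 0] N :=
    fun a b c d => (((hδ.const_mul_left a).add (hE.const_mul_left b)).add
      (oU.const_mul_left c)).add (oV.const_mul_left d)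
  have qU : (fun q => v.quadraticPartU q.2.1 q.2.2 (U q) (V q)) =O[𝓝 0] N :=
    (lin (1 / 2) (-3 / 2 * v.v04 + 3 / 4 * v.v22)
      (3 / 4 * (v.v40 + v.v04) - 3 / 4 * v.v22) (3 / 4 * (v.v40 + v.v04) - 1 / 2 * v.v22)).congr_left
      fun q => by rw [quadraticPartU]; ring
  have qV : (fun q => v.quadraticPartV q.2.1 q.2.2 (U q) (V q)) =O[𝓝 0] N :=
    (lin (1 / 2) (-3 / 2 * v.v04 + 1 / 4 * v.v22)
      (3 / 4 * (v.v40 + v.v04) - 1 / 2 * v.v22) (3 / 4 * (v.v40 + v.v04) - 1 / 4 * v.v22)).congr_left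
      fun q => by rw [quadraticPartV]; ring
  have d₁ := (qU.mul oσ).congr_right (g₂ := fun q => N q ^ 4) fun q => by ring
  have d₂ := (qV.mul oτ).congr_right (g₂ := fun q => N q ^ 4) fun q => by ring
  have d₃ := ((((oξ.add oη).mul (oξ.add oη)).const_mul_left (3 / 8 * (v.v40 + v.v04))).sub
    (((oξ.add oη).mul ((oξ.const_mul_left 3).add oη)).const_mul_left (1 / 8 * v.v22))).congr_right
    (g₂ := fun q => N q ^ 4) fun q => by ring
  refine (((((r₁.sub r₂).add c).add d₁).add d₂).add d₃).congr_left fun q => ?_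
  have hX : (v.scaling (φ q.1)).1 ^ 2 = U q + ξ q := by rw [hξ]; ring
  have hY : (v.scaling (φ q.1)).2 ^ 2 = V q + η q := by rw [hη]; ring
  rw [planar_eq, planar_eq, hX, hY, quadraticPart_add,
    ← truncation_eq_Kb h₁ h₂ hC hα hβ hγ hκ q.2.1 q.2.2 (hU' q) (hV' q)]
  simp only [Prod.fst_zero, Prod.snd_zero, ne_eq, OfNat.ofNat_ne_zero, not_false_eq_true, zero_pow]
  ring

/-- The scaled planar Hamiltonian at `E = δ = 0`. -/
theorem planar_central_scaling (h₁ : v.A - 3 * v.C ≠ 0) (h₂ : v.A - v.C ≠ 0)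
    (r : MvPolynomial (Fin 4) ℝ) (p : ℝ × ℝ) :
    v.planar r 0 0 (v.scaling p) =
      v.ε₁ * (p.1 ^ 2) ^ 2 + v.μ * (p.1 ^ 2 * p.2 ^ 2) + v.ε₂ * (p.2 ^ 2) ^ 2
        + (v.t60 * (p.1 ^ 2) ^ 3 + v.t42 * ((p.1 ^ 2) ^ 2 * p.2 ^ 2)
          + v.t24 * (p.1 ^ 2 * (p.2 ^ 2) ^ 2) + v.t06 * (p.2 ^ 2) ^ 3)
        + MvPolynomial.eval
          ![(√|v.A - 3 * v.C|)⁻¹ * p.1 ^ 2, (√|v.A - v.C|)⁻¹ * p.2 ^ 2, 0, 0] r := by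
  have hP : √|v.A - 3 * v.C| ≠ 0 := by positivity
  have hQ : √|v.A - v.C| ≠ 0 := by positivity
  have hx : (v.scaling p).1 ^ 2 = (√|v.A - 3 * v.C|)⁻¹ * p.1 ^ 2 := by
    rw [scaling, div_pow, sq_abs_rpow_quarter, div_eq_inv_mul]
  have hy : (v.scaling p).2 ^ 2 = (√|v.A - v.C|)⁻¹ * p.2 ^ 2 := by
    rw [scaling, div_pow, sq_abs_rpow_quarter, div_eq_inv_mul]
  have e₁ : v.ε₁ = v.s40 / √|v.A - 3 * v.C| ^ 2 := by rw [ε₁, sq_sqrt_abs, s40]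
  have e₂ : v.ε₂ = v.s04 / √|v.A - v.C| ^ 2 := by rw [ε₂, sq_sqrt_abs, s04]
  rw [← Prod.mk.eta (p := v.scaling p), planar_central, hx, hy,
    show (v.scaling p).1 ^ 4 = ((v.scaling p).1 ^ 2) ^ 2 by ring,
    show (v.scaling p).1 ^ 6 = ((v.scaling p).1 ^ 2) ^ 3 by ring,
    show (v.scaling p).2 ^ 4 = ((v.scaling p).2 ^ 2) ^ 2 by ring,
    show (v.scaling p).2 ^ 6 = ((v.scaling p).2 ^ 2) ^ 3 by ring, hx, hy, e₁, e₂, μ_eq, t60, t42,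
    t24, t06, abs_rpow_half, abs_rpow_half, abs_rpow_three_halves, abs_rpow_three_halves,
    ← s22, ← sq_sqrt_abs (v.A - 3 * v.C), ← sq_sqrt_abs (v.A - v.C)]
  simp only [Real.sqrt_sq (Real.sqrt_nonneg _)]
  ring

end Resonance22.Potential

theorem proposition2 (v : Resonance22.Potential) (r : MvPolynomial (Fin 4) ℝ)
    (hr : ∀ m ∈ r.support, 4 ≤ m.degree)
    (hCA : v.C ≠ v.A) (hCA3 : v.C ≠ v.A / 3) (hC : v.C ≠ 0) :
    (∃ φ : OpenPartialHomeomorph (ℝ × ℝ) (ℝ × ℝ),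
      -- `φ` is a germ of a diffeomorphism at the origin
      ((0 : ℝ × ℝ) ∈ φ.source ∧ φ 0 = 0 ∧
        ContDiffOn ℝ ∞ φ φ.source ∧ ContDiffOn ℝ ∞ φ.symm φ.target) ∧
      -- `φ` respects the two reflections
      (∀ p ∈ φ.source,
        ((-p.1, p.2) ∈ φ.source ∧ φ (-p.1, p.2) = (-(φ p).1, (φ p).2)) ∧
        ((p.1, -p.2) ∈ φ.source ∧ φ (p.1, -p.2) = ((φ p).1, -(φ p).2))) ∧
      -- modulo terms of order five, `φ` is the explicit cubic map
      ((fun p : ℝ × ℝ => φ p - v.cubicMap p) =O[𝓝 0] fun p => ‖p‖ ^ 5) ∧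
      -- at `E = δ = 0` the Hamiltonian becomes the central singularity exactly
      (∀ᶠ p in 𝓝 (0 : ℝ × ℝ), v.planar r 0 0 (v.scaling (φ p)) = v.f p) ∧
      -- `𝓚 ∘ Φ` with `Φ = scaling ∘ φ` has the required form
      v.HasFormKb r (fun p => v.scaling (φ p))) ∧
    -- the explicit cubic map, without further terms, is a suitable transformation as well
    v.HasFormKb r (fun p => v.scaling (v.cubicMap p)) := by
  have h₁ := Resonance22.Potential.A_sub_three_mul_C_ne_zero hCA3
  have h₂ := Resonance22.Potential.A_sub_C_ne_zero hCA
  refine ⟨?_, Resonance22.Potential.hasFormKb_of_sub_cubicMap_isBigO h₁ h₂ hC hr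
    (by simpa using isBigO_zero _ _)⟩
  obtain ⟨R₀, R₁, R₂, R₃, ⟨c₀, c₁, c₂, c₃⟩, ⟨z₀, z₁, z₂, z₃⟩, hR⟩ :=
    r.exists_eval_eq_cubic_combination hr (√|v.A - 3 * v.C|)⁻¹ (√|v.A - v.C|)⁻¹
  obtain ⟨g₀, g₁, g₂, g₃⟩ := Resonance22.Potential.cubicCoeff_homological h₁ h₂ hC
  obtain ⟨z, hz, hz0, hev⟩ := exists_axis_preserving_normalization
    (e₁ := v.ε₁) (m := v.μ) (e₂ := v.ε₂)
    (fun h => by simpa [h] using Resonance22.Potential.ε₁_sq h₁)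
    (fun h => by simpa [h] using Resonance22.Potential.ε₂_sq h₂)
    (Resonance22.Potential.discriminant_ne_zero h₁ h₂ hC)
    (R₀ := fun w => v.t60 + R₀ w) (R₁ := fun w => v.t42 + R₁ w)
    (R₂ := fun w => v.t24 + R₂ w) (R₃ := fun w => v.t06 + R₃ w)
    (by fun_prop) (by fun_prop) (by fun_prop) (by fun_prop)
    (by simpa only [z₀, add_zero] using g₀) (by simpa only [z₁, add_zero] using g₁)
    (by simpa only [z₂, add_zero] using g₂) (by simpa only [z₃, add_zero] using g₃)
  obtain ⟨φ, hdiffeo, hsymm, hφ⟩ := exists_diffeo_eq_reflectionEquivariantMap hz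
  have hcubic : (fun p : ℝ × ℝ => φ p - v.cubicMap p) =O[𝓝 0] fun p => ‖p‖ ^ 5 := by
    refine (reflectionEquivariantMap_sub_cubic_isBigO
      (hz.differentiableAt (by simp))).congr_left fun p => ?_
    rw [hφ, Resonance22.Potential.cubicMap_eq, hz0]
  refine ⟨φ, hdiffeo, hsymm, hcubic, ?_,
    Resonance22.Potential.hasFormKb_of_sub_cubicMap_isBigO h₁ h₂ hC hr hcubic⟩
  have hsq : Tendsto (fun p : ℝ × ℝ => (p.1 ^ 2, p.2 ^ 2)) (𝓝 0) (𝓝 0) := by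
    have : Continuous fun p : ℝ × ℝ => (p.1 ^ 2, p.2 ^ 2) := by fun_prop
    simpa [← Prod.zero_eq_mk] using this.tendsto 0
  filter_upwards [hsq.eventually hev] with p hp
  have key := hp ((φ p).1 ^ 2) ((φ p).2 ^ 2)
    (by rw [hφ, reflectionEquivariantMap, mul_pow]) (by rw [hφ, reflectionEquivariantMap, mul_pow])
  have hRp := hR ((φ p).1 ^ 2, (φ p).2 ^ 2)
  simp only at hRp
  rw [Resonance22.Potential.planar_central_scaling h₁ h₂, hRp, Resonance22.Potential.f]
  linear_combination key
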